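/- Let $V$ be a linear subspace of $\mathbb R^d$ (with a fixed inner product $[\cdot,\cdot]$), let $x_0\in V^\perp$, $U=V+x_0$ and $W=\mathbb R^d/V^\perp$. Put $\langle w,u\rangle=[w,u-x_0]$ for $w\in W$, $u\in U$, and give $W$ the inner product of $V$ via the canonical isomorphism $V\cong W$. Let $\mathcal H$ be a finite set of linear hyperplanes in $W$ whose intersection is $\{0\}$, such that the group $\mathfrak G\subseteq GL(W)$ generated by the orthogonal reflections in the hyperplanes of $\mathcal H$ is finite and $\mathcal H$ is the set of all reflecting hyperplanes of $\mathfrak G$. The group $\mathfrak G$ acts on the right on $U$ by $\langle gw,u\rangle=\langle w,ug\rangle$. Let $\Phi\subseteq W$ be a (closed) chamber of $\mathcal H$ and $\Psi=\{u\in U: u+V^\perp\in\Phi\}$ the corresponding chamber in $U$; $^\circ$ denotes the relative interior. For a polytope $P\subseteq U$ let $\mathfrak G(P)=\operatorname{Conv}\{xg: g\in\mathfrak G,\ x\in P\}$, and let $f_i(P)$ be the number of $i$-dimensional faces of $P$. For a nonempty face $F$ of $P$, let $\operatorname{ncone}(F,P)=\{w\in W:\langle w,y\rangle\ge\langle w,y'\rangle\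 \forall y\in F,\ y'\in P\}$. The fundamental fan $\mathrm{FFan}(P)$ is the set of all nonempty faces of the cones $\operatorname{ncone}(F,P)\cap\Phi$, where $F$ runs over the nonempty faces of $P$, and $f^i(\mathrm{FFan}(P))$ is the number of its cones of codimension $i$ in $W$. The polytope $P$ is called $\Phi$-placed if there is $\gamma\in\Phi^\circ$ such that $\langle\gamma,\cdot\rangle$ is constant on $P$, and $\Psi$-appropriate if $P\subseteq\Psi^\circ$. Then, for every $\Phi$-placed and $\Psi$-appropriate polytope $P\subseteq U$, $$f_0(\mathfrak G(P))=|\mathfrak G|\,f_0(P),\qquad f_1(\mathfrak G(P))=\frac{|\mathfrak G|}{2}\bigl(f^1(\mathrm{FFan}(P))+f_1(P)\bigr).$$ In particular, $f_0(\mathfrak G(P))$ and $f_1(\mathfrak G(P))$ are determined by $f_0(P)$, $f_1(P)$ and $f^1(\mathrm{FFan}(P))$: if two $\Phi$-placed and $\Psi$-appropriate polytopes $P,Q\subseteq U$ agree in these three numbers, then $f_0(\mathfrak G(P))=f_0(\mathfrak G(Q))$ and $f_1(\mathfrak G(P))=f_1(\mathfrak G(Q))$. -/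

import Mathlib

open scoped InnerProductSpace

noncomputable section

namespace Symmetrization

variable {E : Type*} [NormedAddCommGroup E] [InnerProductSpace ℝ E] [FiniteDimensional ℝ E]

/-! ### The dual pair `(U, W)`

`E` is the ambient Euclidean space, with an arbitrary inner product, `V` a linear subspace,
`x₀ ∈ Vᗮ`, `U = V + x₀`, and `W = E / Vᗮ`. -/

/-- The affine space `U = V + x₀`. -/
def affU (V : Submodule ℝ E) (x₀ : E) : AffineSubspace ℝ E := AffineSubspace.mk' x₀ V

/-- The dual space `W = E / Vᗮ` of `V`. -/
abbrev DualSp (V : Submodule ℝ E) : Type _ := E ⧸ Vᗮ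

/-- The canonical identification of `W = E / Vᗮ` with `V`: a class is sent to its unique
representative that lies in `V`. -/
def rep (V : Submodule ℝ E) : DualSp V ≃ₗ[ℝ] V :=
  Submodule.quotientEquivOfIsCompl Vᗮ V V.isCompl_orthogonal.symm

/-- The pairing `⟨w, u⟩ = [w, u - x₀]` between `W` and `U`. -/
def pairing (V : Submodule ℝ E) (x₀ : E) (w : DualSp V) (u : E) : ℝ :=
  ⟪(rep V w : E), u - x₀⟫_ℝ

theorem mk_rep (V : Submodule ℝ E) (w : DualSp V) : Vᗮ.mkQ (rep V w : E) = w := by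
  have h := (rep V).symm_apply_apply w
  rwa [rep, Submodule.quotientEquivOfIsCompl_symm_apply] at h

/-- On `U` the pairing may be computed with any representative of `w`. -/
theorem pairing_mk (V : Submodule ℝ E) (x₀ y u : E) (hu : u ∈ affU V x₀) :
    pairing V x₀ (Vᗮ.mkQ y) u = ⟪y, u - x₀⟫_ℝ := by
  have hu' : u - x₀ ∈ V := by simpa [affU] using hu
  have h1 : ((rep V (Vᗮ.mkQ y) : V) : E) - y ∈ Vᗮ := by
    have h := mk_rep V (Vᗮ.mkQ y)
    exact (Submodule.Quotient.eq _).1 h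
  have h2 : ⟪((rep V (Vᗮ.mkQ y) : V) : E) - y, u - x₀⟫_ℝ = 0 :=
    Submodule.inner_left_of_mem_orthogonal hu' h1
  rw [inner_sub_left] at h2
  unfold pairing
  linarith

/-! ### Reflection groups -/

/-- `H` is a linear hyperplane. -/
def IsHyperplane {V : Submodule ℝ E} (H : Submodule ℝ (DualSp V)) : Prop :=
  Module.finrank ℝ (DualSp V ⧸ H) = 1

/-- The orthogonal reflection of `W` in `H`; the inner product of `W` is that of `V`,
through the canonical identification of `W` with `V`. -/
def refl (V : Submodule ℝ E) (H : Submodule ℝ (DualSp V)) : DualSp V ≃ₗ[ℝ] DualSp V :=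
  (rep V).trans
    (((H.map (rep V).toLinearMap).reflection.toLinearEquiv).trans (rep V).symm)

/-- The group `𝔊 ⊆ GL(W)` generated by the reflections in the hyperplanes of the arrangement. -/
def reflGroup {V : Submodule ℝ E} (𝓗 : Set (Submodule ℝ (DualSp V))) :
    Subgroup (DualSp V ≃ₗ[ℝ] DualSp V) :=
  Subgroup.closure (refl V '' 𝓗)

/-- `𝓗` is a finite arrangement of linear hyperplanes of `W` that meet only in the origin, the
reflections in them generate a finite group, and `𝓗` consists of all the reflecting hyperplanes
of that group (so that the arrangement and the group determine each other). -/
structure IsReflectionArrangement {V : Submodule ℝ E} (𝓗 : Set (Submodule ℝ (DualSp V))) :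
    Prop where
  finite : 𝓗.Finite
  hyperplane : ∀ H ∈ 𝓗, IsHyperplane H
  pointed : sInf 𝓗 = ⊥
  finite_group : Finite (reflGroup 𝓗)
  all_reflections : ∀ H, IsHyperplane H → refl V H ∈ reflGroup 𝓗 → H ∈ 𝓗

/-- `Φ` is a (closed) chamber of the fan of `𝓗`: for some point `w₀` on none of the hyperplanes,
`Φ` is the set of points that lie, for every `H ∈ 𝓗`, in the closed half-space bounded by `H`
that contains `w₀`. -/
def IsChamber {V : Submodule ℝ E} (𝓗 : Set (Submodule ℝ (DualSp V))) (Φ : Set (DualSp V)) :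
    Prop :=
  ∃ w₀ : DualSp V, (∀ H ∈ 𝓗, w₀ ∉ H) ∧
    Φ = {w | ∀ H ∈ 𝓗, ∀ f : DualSp V →ₗ[ℝ] ℝ, LinearMap.ker f = H → 0 ≤ f w₀ * f w}

/-- The chamber `Ψ = Φ^*` of `U` that corresponds to `Φ`: `u ∈ U` is identified with its class
in `W`. -/
def dualChamber (V : Submodule ℝ E) (x₀ : E) (Φ : Set (DualSp V)) : Set E :=
  {u | u ∈ affU V x₀ ∧ Vᗮ.mkQ u ∈ Φ}

/-- The dual right action `u ↦ u g` on `U` of `g ∈ GL(W)`, characterized by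
`⟨g w, u⟩ = ⟨w, u g⟩`. -/
def act (V : Submodule ℝ E) (x₀ : E) (u : E) (g : DualSp V ≃ₗ[ℝ] DualSp V) : E :=
  (LinearMap.adjoint ((rep V).conj g.toLinearMap) (V.orthogonalProjectionOnto (u - x₀)) : E) + x₀

theorem act_mem (V : Submodule ℝ E) (x₀ u : E) (g : DualSp V ≃ₗ[ℝ] DualSp V) :
    act V x₀ u g ∈ affU V x₀ := by
  simp only [act, affU, AffineSubspace.mem_mk', vsub_eq_sub, add_sub_cancel_right]
  exact Submodule.coe_mem _

theorem pairing_act (V : Submodule ℝ E) (x₀ u : E) (hu : u ∈ affU V x₀)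
    (g : DualSp V ≃ₗ[ℝ] DualSp V) (w : DualSp V) :
    pairing V x₀ (g w) u = pairing V x₀ w (act V x₀ u g) := by
  have hu' : u - x₀ ∈ V := by simpa [affU] using hu
  have h1 : V.orthogonalProjectionOnto (u - x₀) = ⟨u - x₀, hu'⟩ :=
    Submodule.orthogonalProjectionOnto_mem_subspace_eq_self (K := V) ⟨u - x₀, hu'⟩
  simp only [pairing, act, add_sub_cancel_right, h1]
  rw [← Submodule.coe_inner, LinearMap.adjoint_inner_right, Submodule.coe_inner]
  simp [LinearEquiv.conj_apply]

/-! ### Polytopes, faces, fans -/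

/-- `P` is a polytope in `U`. -/
def IsPolytopeIn (V : Submodule ℝ E) (x₀ : E) (P : Set E) : Prop :=
  (∃ s : Finset E, P = convexHull ℝ (s : Set E)) ∧ P ⊆ affU V x₀

/-- The dimension of (the affine span of) a set. -/
def dimSet {X : Type*} [AddCommGroup X] [Module ℝ X] (F : Set X) : ℕ :=
  Module.finrank ℝ (vectorSpan ℝ F)

/-- `F` is a nonempty face of the polyhedron `Q`: the set of the points of `Q` at which some
linear functional attains its maximum over `Q`. -/
def IsFace {X : Type*} [AddCommGroup X] [Module ℝ X] [TopologicalSpace X] (Q F : Set X) : Prop :=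
  IsExposed ℝ Q F ∧ F.Nonempty

/-- `f_i(P)`, the number of `i`-dimensional faces of `P`. -/
def fNum (P : Set E) (i : ℕ) : ℕ := {F : Set E | IsFace P F ∧ dimSet F = i}.ncard

/-- The `𝔊`-symmetrization `𝔊(P) = Conv {x g : g ∈ 𝔊, x ∈ P}`. -/
def symmetrization (V : Submodule ℝ E) (x₀ : E) (G : Subgroup (DualSp V ≃ₗ[ℝ] DualSp V))
    (P : Set E) : Set E :=
  convexHull ℝ {y | ∃ g ∈ G, ∃ x ∈ P, y = act V x₀ x g}

/-- The normal cone of `P` at `F` with respect to `W`. -/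
def ncone (V : Submodule ℝ E) (x₀ : E) (F P : Set E) : Set (DualSp V) :=
  {w | ∀ y ∈ F, ∀ y' ∈ P, pairing V x₀ w y' ≤ pairing V x₀ w y}

/-- The normal fan of `P` with respect to `W`. -/
def normalFan (V : Submodule ℝ E) (x₀ : E) (P : Set E) : Set (Set (DualSp V)) :=
  {σ | ∃ F, IsFace P F ∧ σ = ncone V x₀ F P}

/-- The fundamental fan of `P`: the nonempty faces of the cones `σ ∩ Φ`, for `σ` in the normal
fan of `P`. -/
def FFan (V : Submodule ℝ E) (x₀ : E) (Φ : Set (DualSp V)) (P : Set E) :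
    Set (Set (DualSp V)) :=
  {τ | ∃ σ ∈ normalFan V x₀ P, IsFace (σ ∩ Φ) τ}

/-- `f^i(Σ)`, the number of cones of codimension `i` (in `W`) in a collection `Σ` of cones. -/
def fCodim {V : Submodule ℝ E} (S : Set (Set (DualSp V))) (i : ℕ) : ℕ :=
  {τ | τ ∈ S ∧ dimSet τ + i = Module.finrank ℝ (DualSp V)}.ncard

/-- `P` is `Φ`-placed: some functional in the relative interior of `Φ` is constant on `P`. -/
def IsPlaced (V : Submodule ℝ E) (x₀ : E) (Φ : Set (DualSp V)) (P : Set E) : Prop :=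
  ∃ γ ∈ intrinsicInterior ℝ Φ, ∀ x ∈ P, ∀ y ∈ P, pairing V x₀ γ x = pairing V x₀ γ y

/-- `P` is `Ψ`-appropriate: it lies in the relative interior of `Ψ`. -/
def IsAppropriate (Ψ P : Set E) : Prop := P ⊆ intrinsicInterior ℝ Ψ

end Symmetrization

end

open Symmetrization

/-! Identify `U` and `W` with `V`. The group becomes a finite group generated by root reflections,
`P` lies in the open chamber, and the placing functional becomes a vector `γ` of the open chamber.
Let `Q` be the convex hull of the orbit of `P`. Everything rests on one fact: for `c` in the closed
chamber and `x` in the open one, `⟪c, g x⟫ ≤ ⟪c, x⟫`, strictly if `c` is in the open chamber and `g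
≠ 1` (`inner_apply_le`, `inner_apply_lt`). It follows from the freeness of the action on chambers
(`eq_one_of_apply_mem_chamber`), proved through simple roots and the exchange condition.

Three consequences carry the count. The normal cone of `Q` at a nonempty part of `P` is that of `P`
cut by the chamber (`normalCone_orbitHull`). Every face of `P` is a face of `Q`, because it is
exposed by a small perturbation of `γ` (`isFace_orbitHull_of_isFace`). Distinct translates of `P`
are disjoint (`eq_and_eq_of_apply_eq`). So each vertex of `Q` is a translate of a vertex of `P` in
exactly one way, which gives `f_0`.

For `f_1`, count pairs of an edge of `Q` and one of its two vertices. The group acts freely on them,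
and each orbit has one pair whose vertex lies in `P`. An edge contributes one such pair if it meets
`P`, and a second if it is contained in `P`, that is, if it is an edge of `P`. Finally, faces of
normal cones of `Q` are again normal cones of `Q`, so the fundamental fan consists of the normal
cones at the faces of `Q` that meet `P`; its cones of codimension one are the edges meeting `P`
(`ncard_fundamentalFan`). -/

namespace Symmetrization

open Filter Topology

/-! ### Faces and normal cones of a polytope. -/

section Polytope

theorem dimSet_eq_zero_iff {X : Type*} [AddCommGroup X] [Module ℝ X]
    [FiniteDimensional ℝ X] {A : Set X} : dimSet A = 0 ↔ A.Subsingleton := by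
  rw [dimSet, Submodule.finrank_eq_zero, vectorSpan_eq_bot_iff_subsingleton]


variable {F : Type*} [NormedAddCommGroup F] [InnerProductSpace ℝ F]

/-- The convex hull of a finite set. -/
def IsPolytope (Q : Set F) : Prop := ∃ s : Set F, s.Finite ∧ Q = convexHull ℝ s

/-- The points of `Q` at which `⟪c, ·⟫` is maximal. -/
def maxFace (Q : Set F) (c : F) : Set F := {x ∈ Q | ∀ y ∈ Q, ⟪c, y⟫_ℝ ≤ ⟪c, x⟫_ℝ}

/-- The functionals, given as vectors, that attain their maximum over `Q` on all of `S`. -/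
def normalCone (S Q : Set F) : Set F := {c | ∀ y ∈ S, ∀ y' ∈ Q, ⟪c, y'⟫_ℝ ≤ ⟪c, y⟫_ℝ}

theorem maxFace_subset (Q : Set F) (c : F) : maxFace Q c ⊆ Q := fun _ h => h.1

theorem isFace_iff [FiniteDimensional ℝ F] {Q A : Set F} :
    IsFace Q A ↔ A.Nonempty ∧ ∃ c, A = maxFace Q c := by
  have := FiniteDimensional.complete ℝ F
  constructor
  · rintro ⟨h, hn⟩
    obtain ⟨l, hl⟩ := h hn
    refine ⟨hn, (InnerProductSpace.toDual ℝ F).symm l, ?_⟩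
    rw [hl]
    ext x
    simp [maxFace]
  · rintro ⟨hn, c, rfl⟩
    exact ⟨fun _ => ⟨InnerProductSpace.toDual ℝ F c, by ext x; simp [maxFace]⟩, hn⟩

theorem IsFace.subset {X : Type*} [AddCommGroup X] [Module ℝ X] [TopologicalSpace X]
    {Q A : Set X} (h : IsFace Q A) : A ⊆ Q := h.1.subset

theorem mem_normalCone_iff {S Q : Set F} (hS : S ⊆ Q) {c : F} :
    c ∈ normalCone S Q ↔ S ⊆ maxFace Q c :=
  ⟨fun h x hx => ⟨hS hx, fun y hy => h x hx y hy⟩, fun h _ hx y hy => (h hx).2 y hy⟩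

theorem normalCone_anti {S T Q : Set F} (h : S ⊆ T) : normalCone T Q ⊆ normalCone S Q :=
  fun _ hc y hy => hc y (h hy)

theorem zero_mem_normalCone (S Q : Set F) : (0 : F) ∈ normalCone S Q := by
  simp [normalCone]

theorem add_mem_normalCone {S Q : Set F} {c d : F} (hc : c ∈ normalCone S Q)
    (hd : d ∈ normalCone S Q) : c + d ∈ normalCone S Q := by
  intro y hy y' hy'
  rw [inner_add_left, inner_add_left]
  exact add_le_add (hc y hy y' hy') (hd y hy y' hy')

theorem inner_le_of_mem_convexHull {s : Set F} {c x : F} {r : ℝ} (hx : x ∈ convexHull ℝ s)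
    (h : ∀ y ∈ s, ⟪c, y⟫_ℝ ≤ r) : ⟪c, x⟫_ℝ ≤ r := by
  have hconv : Convex ℝ {y : F | ⟪c, y⟫_ℝ ≤ r} := by
    apply convex_halfSpace_le (IsLinearMap.mk _ _)
    · intro x y; exact inner_add_right _ _ _
    · intro a x; exact real_inner_smul_right _ _ _
  exact convexHull_min h hconv hx

theorem convex_maxFace {Q : Set F} (hQ : Convex ℝ Q) (c : F) : Convex ℝ (maxFace Q c) := by
  intro x hx y hy a b ha hb hab
  refine ⟨hQ hx.1 hy.1 ha hb hab, fun z hz => ?_⟩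
  have h1 := hx.2 z hz
  have h2 := hy.2 z hz
  rw [inner_add_right, real_inner_smul_right, real_inner_smul_right]
  calc ⟪c, z⟫_ℝ = a * ⟪c, z⟫_ℝ + b * ⟪c, z⟫_ℝ := by rw [← add_mul, hab, one_mul]
    _ ≤ _ := add_le_add (mul_le_mul_of_nonneg_left h1 ha) (mul_le_mul_of_nonneg_left h2 hb)

theorem inner_eq_of_mem_maxFace {Q : Set F} {c x y : F} (hx : x ∈ maxFace Q c)
    (hy : y ∈ maxFace Q c) : ⟪c, x⟫_ℝ = ⟪c, y⟫_ℝ :=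
  le_antisymm (hy.2 x hx.1) (hx.2 y hy.1)

theorem maxFace_nonempty {Q : Set F} (hQ : IsCompact Q) (hn : Q.Nonempty) (c : F) :
    (maxFace Q c).Nonempty := by
  obtain ⟨x, hx, h⟩ := hQ.exists_isMaxOn hn
    (f := fun y => ⟪c, y⟫_ℝ) (by fun_prop)
  exact ⟨x, hx, fun y hy => h hy⟩

theorem isCompact_maxFace {Q : Set F} (hQ : IsCompact Q) (c : F) : IsCompact (maxFace Q c) := by
  have : maxFace Q c = Q ∩ ⋂ y ∈ Q, {x | ⟪c, y⟫_ℝ ≤ ⟪c, x⟫_ℝ} := by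
    ext x; simp [maxFace]
  rw [this]
  refine hQ.inter_right (isClosed_biInter fun y _ => ?_)
  exact isClosed_le continuous_const (by fun_prop)

namespace IsPolytope

variable {Q : Set F} (hQ : IsPolytope Q)
include hQ

theorem isCompact : IsCompact Q := by
  obtain ⟨s, hs, rfl⟩ := hQ
  exact hs.isCompact_convexHull (𝕜 := ℝ)

theorem convex : Convex ℝ Q := by
  obtain ⟨s, hs, rfl⟩ := hQ
  exact convex_convexHull ℝ s

/-- For small `ε > 0`, maximizing `c₀ + ε c` means maximizing `c₀` first and `c` second. -/
theorem maxFace_add_smul (c₀ c : F) :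
    ∀ᶠ ε : ℝ in 𝓝[>] 0, maxFace Q (c₀ + ε • c) = maxFace (maxFace Q c₀) c := by
  rcases Q.eq_empty_or_nonempty with rfl | hn
  · simp [maxFace]
  have hc := hQ.isCompact
  obtain ⟨y₀, hy₀⟩ := maxFace_nonempty (isCompact_maxFace hc c₀) (maxFace_nonempty hc hn c₀) c
  have key : ∀ᶠ ε : ℝ in 𝓝[>] 0, ∀ x ∈ Q, ⟪c₀ + ε • c, x⟫_ℝ ≤ ⟪c₀ + ε • c, y₀⟫_ℝ := by
    obtain ⟨s, hs, rfl⟩ := hQ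
    have h1 : ∀ x ∈ s, ∀ᶠ ε : ℝ in 𝓝[>] 0, ⟪c₀ + ε • c, x⟫_ℝ ≤ ⟪c₀ + ε • c, y₀⟫_ℝ := by
      intro x hx
      have hxQ := subset_convexHull ℝ s hx
      rcases (hy₀.1.2 x hxQ).lt_or_eq with hlt | heq
      · have h2 : ∀ᶠ ε : ℝ in 𝓝 0, ⟪c₀ + ε • c, x⟫_ℝ < ⟪c₀ + ε • c, y₀⟫_ℝ := by
          apply ContinuousAt.eventually_lt
          · fun_prop
          · fun_prop
          · simpa using hlt
        exact (h2.filter_mono nhdsWithin_le_nhds).mono fun _ h => h.le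
      · have hx' : x ∈ maxFace (convexHull ℝ s) c₀ :=
          ⟨hxQ, fun y hy => heq ▸ hy₀.1.2 y hy⟩
        filter_upwards [self_mem_nhdsWithin] with ε hε
        rw [inner_add_left, inner_add_left, real_inner_smul_left, real_inner_smul_left, heq]
        have := hy₀.2 x hx'
        have hε' : (0 : ℝ) < ε := hε
        simpa using mul_le_mul_of_nonneg_left this hε'.le
    have h2 : ∀ᶠ ε : ℝ in 𝓝[>] 0, ∀ x ∈ s, ⟪c₀ + ε • c, x⟫_ℝ ≤ ⟪c₀ + ε • c, y₀⟫_ℝ :=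
      (eventually_all_finite hs).2 h1
    exact h2.mono fun ε h x hx => inner_le_of_mem_convexHull hx h
  -- A maximizer `x` at `ε`, compared with the optimality of `y₀` at `2 * ε`, satisfies `⟪c₀, y₀⟫ ≤
  -- ⟪c₀, x⟫`; this is what puts `x` in `maxFace Q c₀`.
  have hdouble : Tendsto (fun ε : ℝ => 2 * ε) (𝓝[>] 0) (𝓝[>] 0) := by
    refine tendsto_nhdsWithin_iff.2 ⟨?_, ?_⟩
    · have : Tendsto (fun ε : ℝ => 2 * ε) (𝓝 0) (𝓝 (2 * 0)) :=
        Continuous.tendsto (by fun_prop) 0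
      rw [mul_zero] at this
      exact this.mono_left nhdsWithin_le_nhds
    · filter_upwards [self_mem_nhdsWithin] with ε hε
      have : (0 : ℝ) < ε := hε
      simpa using this
  filter_upwards [key, hdouble.eventually key, self_mem_nhdsWithin] with ε h1 h2 hε
  have hε' : (0 : ℝ) < ε := hε
  have expand : ∀ (t : ℝ) (x : F), ⟪c₀ + t • c, x⟫_ℝ = ⟪c₀, x⟫_ℝ + t * ⟪c, x⟫_ℝ := by
    intro t x; rw [inner_add_left, real_inner_smul_left]
  simp only [expand] at h1 h2
  ext x
  constructor
  · intro hx
    have e1 := hx.2 y₀ hy₀.1.1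
    have e2 := h2 x hx.1
    have e3 := hy₀.1.2 x hx.1
    simp only [expand] at e1
    have e4 : ⟪c₀, x⟫_ℝ = ⟪c₀, y₀⟫_ℝ := by linarith
    have hx' : x ∈ maxFace Q c₀ := ⟨hx.1, fun y hy => e4 ▸ hy₀.1.2 y hy⟩
    have e5 : ⟪c, y₀⟫_ℝ ≤ ⟪c, x⟫_ℝ := by
      have : ε * ⟪c, y₀⟫_ℝ ≤ ε * ⟪c, x⟫_ℝ := by linarith
      exact le_of_mul_le_mul_left this hε'
    exact ⟨hx', fun y hy => (hy₀.2 y hy).trans e5⟩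
  · intro hx
    refine ⟨hx.1.1, fun y hy => ?_⟩
    have e1 := inner_eq_of_mem_maxFace hx.1 hy₀.1
    have e2 := inner_eq_of_mem_maxFace hx hy₀
    simp only [expand]
    rw [e1, e2]
    exact h1 y hy

theorem exists_maxFace_add_smul (c₀ c : F) :
    ∃ ε : ℝ, 0 < ε ∧ maxFace Q (c₀ + ε • c) = maxFace (maxFace Q c₀) c := by
  obtain ⟨ε, h, hε⟩ := ((hQ.maxFace_add_smul c₀ c).and self_mem_nhdsWithin).exists
  exact ⟨ε, hε, h⟩

theorem isFace_maxFace [FiniteDimensional ℝ F] {A : Set F} (hA : IsFace Q A) (c : F) :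
    IsFace Q (maxFace A c) := by
  obtain ⟨hn, c₀, rfl⟩ := isFace_iff.1 hA
  obtain ⟨ε, -, h⟩ := hQ.exists_maxFace_add_smul c₀ c
  exact isFace_iff.2 ⟨maxFace_nonempty (isCompact_maxFace hQ.isCompact c₀) hn c, _, h.symm⟩

theorem isCompact_face [FiniteDimensional ℝ F] {A : Set F} (hA : IsFace Q A) : IsCompact A := by
  obtain ⟨hn, c₀, rfl⟩ := isFace_iff.1 hA
  exact isCompact_maxFace hQ.isCompact c₀

theorem convex_face [FiniteDimensional ℝ F] {A : Set F} (hA : IsFace Q A) : Convex ℝ A := by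
  obtain ⟨hn, c₀, rfl⟩ := isFace_iff.1 hA
  exact convex_maxFace hQ.convex c₀

/-- By Krein–Milman a face is recovered from its extreme points, and these form a subset of the
finite set of extreme points of `Q`. -/
theorem finite_faces [FiniteDimensional ℝ F] : {A | IsFace Q A}.Finite := by
  have hfin : (Q.extremePoints ℝ).Finite := by
    obtain ⟨s, hs, rfl⟩ := hQ
    exact hs.subset extremePoints_convexHull_subset
  refine Set.Finite.of_finite_image
    (f := fun A : Set F => A.extremePoints ℝ) (hfin.finite_subsets.subset ?_) ?_
  · rintro _ ⟨A, hA, rfl⟩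
    exact (hA.1.isExtreme).extremePoints_subset_extremePoints
  · intro A hA B hB hAB
    rw [← closure_convexHull_extremePoints (hQ.isCompact_face hA) (hQ.convex_face hA),
      ← closure_convexHull_extremePoints (hQ.isCompact_face hB) (hQ.convex_face hB)]
    simp only [] at hAB
    rw [hAB]

/-- An exposed face of a normal cone of `Q` is a normal cone of `Q` at a face. -/
theorem exists_face_of_isFace_normalCone [FiniteDimensional ℝ F] {S τ : Set F} (hS : S ⊆ Q)
    (hSn : S.Nonempty) (hτ : IsFace (normalCone S Q) τ) :
    ∃ A, IsFace Q A ∧ S ⊆ A ∧ τ = normalCone A Q := by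
  obtain ⟨hn, l, rfl⟩ := isFace_iff.1 hτ
  set N := normalCone S Q
  -- `N` contains `0` and is closed under doubling, so an attained maximum of `l` on it must be `0`.
  have hl : ∀ c ∈ maxFace N l, ⟪l, c⟫_ℝ = 0 := by
    intro c hc
    have h1 := hc.2 0 (zero_mem_normalCone S Q)
    have h2 := hc.2 _ (add_mem_normalCone hc.1 hc.1)
    rw [inner_add_right] at h2
    rw [inner_zero_right] at h1
    linarith
  have hle : ∀ c ∈ N, ⟪l, c⟫_ℝ ≤ 0 := by
    intro c hc
    obtain ⟨d, hd⟩ := hn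
    exact (hd.2 c hc).trans_eq (hl d hd)
  have hmem : ∀ c ∈ N, 0 ≤ ⟪l, c⟫_ℝ → c ∈ maxFace N l :=
    fun c hc h => ⟨hc, fun d hd => (hle d hd).trans h⟩
  have hfin : (maxFace Q '' maxFace N l).Finite := by
    refine hQ.finite_faces.subset ?_
    rintro _ ⟨c, hc, rfl⟩
    exact isFace_iff.2 ⟨hSn.mono ((mem_normalCone_iff hS).1 hc.1), c, rfl⟩
  -- A `c₀` exposing a minimal face plays the role of a relative interior point of the cone `maxFace
  -- N l`.
  obtain ⟨A, ⟨⟨c₀, hc₀, rfl⟩, hmin⟩⟩ := hfin.exists_minimal (hn.image _)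
  have hSA : S ⊆ maxFace Q c₀ := (mem_normalCone_iff hS).1 hc₀.1
  refine ⟨maxFace Q c₀, isFace_iff.2 ⟨hSn.mono hSA, c₀, rfl⟩, hSA,
    Set.Subset.antisymm ?_ ?_⟩
  · intro c hc
    rw [mem_normalCone_iff (maxFace_subset _ _)]
    have hsum : c₀ + c ∈ maxFace N l := by
      refine hmem _ (add_mem_normalCone hc₀.1 hc.1) ?_
      rw [inner_add_right, hl _ hc₀, hl _ hc, add_zero]
    obtain ⟨s, hs⟩ := hSn
    have hs0 := hSA hs
    have hs1 := (mem_normalCone_iff hS).1 hc.1 hs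
    -- `c₀` and `c` have the common maximizer `s`, so maximizers of the sum maximize both.
    -- Minimality of the face of `c₀` then puts it inside that of `c`.
    have key : ∀ x ∈ maxFace Q (c₀ + c), x ∈ maxFace Q c₀ ∧ x ∈ maxFace Q c := by
      intro x hx
      have e1 := hx.2 s (hS hs)
      rw [inner_add_left, inner_add_left] at e1
      have e2 := hs0.2 x hx.1
      have e3 := hs1.2 x hx.1
      have e4 : ⟪c₀, x⟫_ℝ = ⟪c₀, s⟫_ℝ := by linarith
      have e5 : ⟪c, x⟫_ℝ = ⟪c, s⟫_ℝ := by linarith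
      exact ⟨⟨hx.1, fun y hy => e4 ▸ hs0.2 y hy⟩, ⟨hx.1, fun y hy => e5 ▸ hs1.2 y hy⟩⟩
    have h1 := hmin ⟨_, hsum, rfl⟩ (fun x hx => (key x hx).1)
    exact fun x hx => (key x (h1 hx)).2
  · intro c hc
    have hcN : c ∈ N := normalCone_anti hSA hc
    refine hmem c hcN ?_
    -- As `c` is constant on the face of `c₀`, one can step from `c₀` slightly in the direction `-c`
    -- without leaving `N`; since `l` vanishes at `c₀`, it cannot be negative at `c`.
    obtain ⟨ε, hε, h⟩ := hQ.exists_maxFace_add_smul c₀ (-c)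
    have hconst : maxFace (maxFace Q c₀) (-c) = maxFace Q c₀ := by
      refine Set.Subset.antisymm (maxFace_subset _ _) fun x hx => ⟨hx, fun y hy => ?_⟩
      rw [inner_neg_left, inner_neg_left, neg_le_neg_iff]
      exact hc y hy x hx.1
    rw [hconst] at h
    have h1 : c₀ + ε • -c ∈ N := (mem_normalCone_iff hS).2 (h ▸ hSA)
    have h2 := hle _ h1
    rw [inner_add_right, hl _ hc₀, real_inner_smul_right, inner_neg_right] at h2
    by_contra hneg
    push Not at hneg
    nlinarith

omit hQ in
/-- The normal cone at a face is an exposed face of the normal cone at any nonempty subset. -/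
theorem isFace_normalCone [FiniteDimensional ℝ F] (hQ : IsPolytope Q) {S A : Set F}
    (hSn : S.Nonempty) (hA : IsFace Q A) (hSA : S ⊆ A) :
    IsFace (normalCone S Q) (normalCone A Q) := by
  obtain ⟨s, hs⟩ := hSn
  have hfin : (A.extremePoints ℝ).Finite := by
    obtain ⟨s, hs, rfl⟩ := hQ
    exact (hs.subset extremePoints_convexHull_subset).subset
      hA.1.isExtreme.extremePoints_subset_extremePoints
  have hAhull := closure_convexHull_extremePoints (hQ.isCompact_face hA) (hQ.convex_face hA)
  have hAhull' : convexHull ℝ (A.extremePoints ℝ) = A := by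
    exact (hfin.isCompact_convexHull (𝕜 := ℝ)).isClosed.closure_eq.symm.trans hAhull
  have hinner : ∀ c, ⟪∑ q ∈ hfin.toFinset, (q - s), c⟫_ℝ
      = ∑ q ∈ hfin.toFinset, (⟪c, q⟫_ℝ - ⟪c, s⟫_ℝ) := by
    intro c
    rw [sum_inner]
    exact Finset.sum_congr rfl fun q _ => by rw [real_inner_comm, inner_sub_right]
  have hnonpos : ∀ c ∈ normalCone S Q, ∀ q ∈ hfin.toFinset, ⟪c, q⟫_ℝ - ⟪c, s⟫_ℝ ≤ 0 := by
    intro c hc q hq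
    rw [Set.Finite.mem_toFinset] at hq
    exact sub_nonpos.2 (hc s hs q (hA.subset hq.1))
  -- Each summand is nonpositive on the cone of `S`, so the sum vanishes at `c` exactly when every
  -- extreme point of `A` ties with `s` under `c`.
  refine isFace_iff.2 ⟨⟨0, zero_mem_normalCone _ _⟩, ∑ q ∈ hfin.toFinset, (q - s), ?_⟩
  ext c
  constructor
  · intro hc
    refine ⟨normalCone_anti hSA hc, fun d hd => ?_⟩
    rw [hinner, hinner]
    refine (Finset.sum_nonpos (hnonpos d hd)).trans (Finset.sum_nonneg fun q hq => ?_)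
    rw [Set.Finite.mem_toFinset] at hq
    exact sub_nonneg.2 (hc q hq.1 s (hA.subset (hSA hs)))
  · intro hc
    have h0 := hc.2 0 (zero_mem_normalCone _ _)
    rw [hinner, hinner] at h0
    have hz : ∑ q ∈ hfin.toFinset, (⟪c, q⟫_ℝ - ⟪c, s⟫_ℝ) = 0 :=
      le_antisymm (Finset.sum_nonpos (hnonpos c hc.1)) (by simpa using h0)
    rw [Finset.sum_eq_zero_iff_of_nonpos (hnonpos c hc.1)] at hz
    have hge : ∀ x ∈ A, ⟪-c, x⟫_ℝ ≤ -⟪c, s⟫_ℝ := by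
      intro x hx
      rw [← hAhull'] at hx
      refine inner_le_of_mem_convexHull hx fun q hq => ?_
      have := hz q (hfin.mem_toFinset.2 hq)
      rw [inner_neg_left]; linarith
    intro x hx y hy
    have h1 := hge x hx
    have h2 := hc.1 s hs y hy
    rw [inner_neg_left] at h1
    linarith

-- A face is recovered from its cone: a functional exposing `B` lies in the normal cone at `B`, and
-- if it also lies in the cone at `A` then `A ⊆ B`.
omit hQ in
theorem normalCone_injOn [FiniteDimensional ℝ F] :
    Set.InjOn (fun A => normalCone A Q) {A | IsFace Q A} := by
  have key : ∀ A B, IsFace Q A → IsFace Q B → normalCone A Q = normalCone B Q → A ⊆ B := by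
    intro A B hA hB h
    obtain ⟨hn, c, rfl⟩ := isFace_iff.1 hB
    have : c ∈ normalCone (maxFace Q c) Q :=
      (mem_normalCone_iff (maxFace_subset _ _)).2 subset_rfl
    rw [← h] at this
    exact (mem_normalCone_iff hA.subset).1 this
  intro A hA B hB h
  exact Set.Subset.antisymm (key A B hA hB h) (key B A hB hA h.symm)

/-- Functionals in the cone are constant on `A`. Conversely, a small multiple of a `c` orthogonal to
`A` can be added to a functional exposing `A` without changing the exposed face. -/
theorem vectorSpan_normalCone [FiniteDimensional ℝ F] {A : Set F} (hA : IsFace Q A) :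
    vectorSpan ℝ (normalCone A Q) = (vectorSpan ℝ A)ᗮ := by
  obtain ⟨hn, c₀, rfl⟩ := isFace_iff.1 hA
  apply le_antisymm
  · rw [vectorSpan_def, Submodule.span_le]
    rintro _ ⟨c, hc, d, hd, rfl⟩
    rw [SetLike.mem_coe, Submodule.mem_orthogonal']
    intro u hu
    rw [vectorSpan_def] at hu
    induction hu using Submodule.span_induction with
    | mem u hu =>
      obtain ⟨x, hx, y, hy, rfl⟩ := hu
      simp only [vsub_eq_sub, inner_sub_left, inner_sub_right]
      have := hc x hx y hy.1
      have := hc y hy x hx.1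
      have := hd x hx y hy.1
      have := hd y hy x hx.1
      linarith
    | zero => simp
    | add x y _ _ h1 h2 => rw [inner_add_right, h1, h2, add_zero]
    | smul a x _ h => rw [real_inner_smul_right, h, mul_zero]
  · intro c hc
    rw [Submodule.mem_orthogonal'] at hc
    obtain ⟨ε, hε, h⟩ := hQ.exists_maxFace_add_smul c₀ c
    have hconst : maxFace (maxFace Q c₀) c = maxFace Q c₀ := by
      refine Set.Subset.antisymm (maxFace_subset _ _) fun x hx => ⟨hx, fun y hy => ?_⟩
      have := hc _ (vsub_mem_vectorSpan ℝ hx hy)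
      rw [vsub_eq_sub, inner_sub_right] at this
      linarith
    rw [hconst] at h
    have h0 : c₀ ∈ normalCone (maxFace Q c₀) Q :=
      (mem_normalCone_iff (maxFace_subset _ _)).2 subset_rfl
    have h1 : c₀ + ε • c ∈ normalCone (maxFace Q c₀) Q :=
      (mem_normalCone_iff (maxFace_subset _ _)).2 h.symm.subset
    have h2 := vsub_mem_vectorSpan ℝ h1 h0
    rw [vsub_eq_sub, add_sub_cancel_left] at h2
    exact (Submodule.smul_mem_iff _ hε.ne').1 h2

theorem dimSet_normalCone [FiniteDimensional ℝ F] {A : Set F} (hA : IsFace Q A) :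
    dimSet (normalCone A Q) + dimSet A = Module.finrank ℝ F := by
  rw [dimSet, dimSet, hQ.vectorSpan_normalCone hA, add_comm]
  exact Submodule.finrank_add_finrank_orthogonal _

/-- A one-dimensional face is the segment between two vertices, and has no other vertices. -/
theorem exists_segment_of_dimSet_eq_one [FiniteDimensional ℝ F] {A : Set F} (hA : IsFace Q A)
    (hd : dimSet A = 1) :
    ∃ a b, a ≠ b ∧ IsFace Q {a} ∧ IsFace Q {b} ∧ a ∈ A ∧ b ∈ A ∧ A ⊆ segment ℝ a b ∧
      ∀ x ∈ A, IsFace Q {x} → x = a ∨ x = b := by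
  obtain ⟨⟨d, hdA⟩, hd0, hspan⟩ := finrank_eq_one_iff'.1 hd
  have hd0' : d ≠ 0 := fun h => hd0 (Subtype.ext h)
  have hdd : 0 < ⟪d, d⟫_ℝ := real_inner_self_pos.2 hd0'
  have hline : ∀ x ∈ A, ∀ y ∈ A, ∃ t : ℝ, x = y + t • d := by
    intro x hx y hy
    obtain ⟨t, ht⟩ := hspan ⟨x - y, vsub_mem_vectorSpan ℝ hx hy⟩
    have : t • d = x - y := congrArg Subtype.val ht
    exact ⟨t, by rw [this]; abel⟩
  have hAc := hQ.isCompact_face hA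
  obtain ⟨b, hb⟩ := maxFace_nonempty hAc hA.2 d
  obtain ⟨a, ha⟩ := maxFace_nonempty hAc hA.2 (-d)
  have hb' : maxFace A d = {b} := by
    refine Set.eq_singleton_iff_unique_mem.2 ⟨hb, fun x hx => ?_⟩
    obtain ⟨t, rfl⟩ := hline x hx.1 b hb.1
    have := inner_eq_of_mem_maxFace hx hb
    rw [inner_add_right, real_inner_smul_right] at this
    have : t = 0 := by
      have h : t * ⟪d, d⟫_ℝ = 0 := by linarith
      exact (mul_eq_zero.1 h).resolve_right hdd.ne'
    simp [this]
  have ha' : maxFace A (-d) = {a} := by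
    refine Set.eq_singleton_iff_unique_mem.2 ⟨ha, fun x hx => ?_⟩
    obtain ⟨t, rfl⟩ := hline x hx.1 a ha.1
    have := inner_eq_of_mem_maxFace hx ha
    rw [inner_neg_left, inner_neg_left, inner_add_right, real_inner_smul_right] at this
    have : t = 0 := by
      have h : t * ⟪d, d⟫_ℝ = 0 := by linarith
      exact (mul_eq_zero.1 h).resolve_right hdd.ne'
    simp [this]
  have hlow : ∀ x ∈ A, ⟪d, a⟫_ℝ ≤ ⟪d, x⟫_ℝ := by
    intro x hx
    have := ha.2 x hx
    rw [inner_neg_left, inner_neg_left] at this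
    linarith
  have hab : a ≠ b := by
    rintro rfl
    have hsub : A.Subsingleton := by
      have : A ⊆ {a} := by
        intro x hx
        rw [← hb']
        exact ⟨hx, fun y hy => (hb.2 y hy).trans (hlow x hx)⟩
      exact Set.subsingleton_singleton.anti this
    rw [dimSet_eq_zero_iff.2 hsub] at hd
    exact zero_ne_one hd
  have hseg : A ⊆ segment ℝ a b := by
    intro x hx
    obtain ⟨t, rfl⟩ := hline x hx a ha.1
    obtain ⟨T, rfl⟩ := hline b hb.1 a ha.1
    have h1 := hlow _ hx
    have h2 := hb.2 _ hx
    simp only [inner_add_right, real_inner_smul_right] at h1 h2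
    have ht : 0 ≤ t := by
      by_contra h
      push Not at h
      nlinarith
    have htT : t ≤ T := le_of_mul_le_mul_right (by linarith) hdd
    have hT : 0 < T := lt_of_le_of_ne (ht.trans htT) fun h => hab (by simp [← h])
    rw [segment_eq_image']
    refine ⟨t / T, ⟨div_nonneg ht hT.le, (div_le_one hT).2 htT⟩, ?_⟩
    simp only [add_sub_cancel_left, smul_smul]
    rw [div_mul_cancel₀ _ hT.ne']
  refine ⟨a, b, hab, ha' ▸ hQ.isFace_maxFace hA _, hb' ▸ hQ.isFace_maxFace hA _, ha.1, hb.1,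
    hseg, fun x hx hxf => ?_⟩
  obtain ⟨-, w, hw⟩ := isFace_iff.1 hxf
  have hxw : x ∈ maxFace Q w := hw ▸ rfl
  by_contra hne
  push Not at hne
  -- A functional with unique maximizer `x` would be strictly smaller at `a` and `b`, contradicting
  -- that `x` is a convex combination of them.
  have hlt : ∀ y ∈ A, y ≠ x → ⟪w, y⟫_ℝ < ⟪w, x⟫_ℝ := by
    intro y hy hyx
    by_contra h
    push Not at h
    have : y ∈ maxFace Q w := ⟨hA.subset hy, fun z hz => (hxw.2 z hz).trans h⟩
    rw [← hw] at this
    exact hyx this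
  obtain ⟨p, q, hp, hq, hpq, hx'⟩ := hseg hx
  have h1 := hlt a ha.1 hne.1.symm
  have h2 := hlt b hb.1 hne.2.symm
  have h3 : ⟪w, x⟫_ℝ = p * ⟪w, a⟫_ℝ + q * ⟪w, b⟫_ℝ := by
    rw [← hx', inner_add_right, real_inner_smul_right, real_inner_smul_right]
  have h4 : ⟪w, x⟫_ℝ = p * ⟪w, x⟫_ℝ + q * ⟪w, x⟫_ℝ := by rw [← add_mul, hpq, one_mul]
  rcases hp.eq_or_lt with rfl | hp
  · have : q = 1 := by linarith
    subst this
    linarith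
  · nlinarith [mul_lt_mul_of_pos_left h1 hp, mul_le_mul_of_nonneg_left h2.le hq]

/-- Every nonempty face contains a vertex. -/
theorem exists_vertex [FiniteDimensional ℝ F] {A : Set F} (hA : IsFace Q A) :
    ∃ x ∈ A, IsFace Q {x} := by
  obtain ⟨n, hn⟩ : ∃ n, dimSet A = n := ⟨_, rfl⟩
  induction n using Nat.strong_induction_on generalizing A with
  | _ n ih =>
    by_cases hs : A.Subsingleton
    · obtain ⟨x, hx⟩ := hA.2
      exact ⟨x, hx, (hs.eq_singleton_of_mem hx) ▸ hA⟩
    · rw [Set.not_subsingleton_iff] at hs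
      obtain ⟨x, hx, y, hy, hxy⟩ := hs
      -- The dimension drops, since `x - y` is a nonzero direction of `A` orthogonal to every
      -- direction of this subface.
      have hB := hQ.isFace_maxFace hA (x - y)
      have hlt : dimSet (maxFace A (x - y)) < n := by
        rw [← hn]
        refine Submodule.finrank_lt_finrank_of_lt (lt_of_le_of_ne
          (vectorSpan_mono ℝ (maxFace_subset _ _)) fun h => ?_)
        have hmem : x - y ∈ vectorSpan ℝ (maxFace A (x - y)) := by
          rw [h]; exact vsub_mem_vectorSpan ℝ hx hy
        have horth : ∀ u ∈ vectorSpan ℝ (maxFace A (x - y)), ⟪x - y, u⟫_ℝ = 0 := by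
          intro u hu
          rw [vectorSpan_def] at hu
          induction hu using Submodule.span_induction with
          | mem u hu =>
            obtain ⟨p, hp, q, hq, rfl⟩ := hu
            simp only [vsub_eq_sub]
            rw [inner_sub_right, inner_eq_of_mem_maxFace hp hq, sub_self]
          | zero => simp
          | add x y _ _ h1 h2 => rw [inner_add_right, h1, h2, add_zero]
          | smul a x _ h => rw [real_inner_smul_right, h, mul_zero]
        exact hxy (sub_eq_zero.1 (inner_self_eq_zero.1 (horth _ hmem)))
      obtain ⟨z, hz, hzf⟩ := ih _ hlt hB rfl
      exact ⟨z, maxFace_subset _ _ hz, hzf⟩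

end IsPolytope

end Polytope

end Symmetrization

namespace Symmetrization

/-! ### Finite reflection groups: simple roots, exchange, and maxima over orbits. -/

section PositiveSystem

variable {F : Type*} [NormedAddCommGroup F] [InnerProductSpace ℝ F]

/-- The orthogonal reflection in the hyperplane orthogonal to `α`. -/
noncomputable def rootRefl (α : F) : F ≃ₗᵢ[ℝ] F := (ℝ ∙ α)ᗮ.reflection

theorem rootRefl_apply {α : F} (hα : ‖α‖ = 1) (x : F) :
    rootRefl α x = x - (2 * ⟪α, x⟫_ℝ) • α := by
  rw [rootRefl, Submodule.reflection_orthogonal_apply, Submodule.reflection_singleton_apply]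
  simp [hα, mul_smul, two_smul]

theorem rootRefl_mul_self (α : F) : rootRefl α * rootRefl α = 1 :=
  Submodule.reflection_mul_reflection _

theorem rootRefl_inv (α : F) : (rootRefl α)⁻¹ = rootRefl α := Submodule.reflection_inv

theorem rootRefl_self (α : F) : rootRefl α α = -α :=
  Submodule.reflection_orthogonalComplement_singleton_eq_neg α

theorem rootRefl_neg (α : F) : rootRefl (-α) = rootRefl α := by
  rw [rootRefl, rootRefl]
  have : (ℝ ∙ (-α)) = ℝ ∙ α := by
    rw [← Set.neg_singleton, Submodule.span_neg]
  simp only [this]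

theorem linearIsometryEquiv_mul_apply (g h : F ≃ₗᵢ[ℝ] F) (x : F) : (g * h) x = g (h x) := rfl

theorem inner_symm_apply (g : F ≃ₗᵢ[ℝ] F) (x y : F) : ⟪g⁻¹ x, y⟫_ℝ = ⟪x, g y⟫_ℝ := by
  rw [← g.inner_map_map (g⁻¹ x) y]
  congr 1
  exact g.apply_symm_apply x

theorem rootRefl_map {α : F} (hα : ‖α‖ = 1) (g : F ≃ₗᵢ[ℝ] F) :
    rootRefl (g α) = g * rootRefl α * g⁻¹ := by
  ext x
  have h1 : g (g⁻¹ x) = x := g.apply_symm_apply x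
  rw [rootRefl_apply (by rw [g.norm_map, hα]), linearIsometryEquiv_mul_apply,
    linearIsometryEquiv_mul_apply, rootRefl_apply hα, map_sub, map_smul, h1, real_inner_comm,
    ← inner_symm_apply, real_inner_comm]

/-- `R` is the set of unit normals, on the side of `x₀`, of an arrangement of hyperplanes that is
stable under its reflections and avoids `x₀`. -/
structure IsPositiveSystem (R : Set F) (x₀ : F) : Prop where
  finite : R.Finite
  norm_eq_one : ∀ α ∈ R, ‖α‖ = 1
  pos : ∀ α ∈ R, 0 < ⟪α, x₀⟫_ℝ
  refl_mem : ∀ α ∈ R, ∀ β ∈ R, rootRefl α β ∈ R ∨ -rootRefl α β ∈ R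

/-- A root is simple if its reflection keeps all other positive roots positive. -/
def IsSimpleRoot (R : Set F) (α : F) : Prop := α ∈ R ∧ ∀ δ ∈ R, δ ≠ α → rootRefl α δ ∈ R

/-- The group generated by the reflections in the roots. -/
def rootGroup (R : Set F) : Subgroup (F ≃ₗᵢ[ℝ] F) := Subgroup.closure (rootRefl '' R)

/-- The closed chamber of the roots `R`. -/
def chamber (R : Set F) : Set F := {c | ∀ α ∈ R, 0 ≤ ⟪α, c⟫_ℝ}

/-- The open chamber of the roots `R`. -/
def openChamber (R : Set F) : Set F := {c | ∀ α ∈ R, 0 < ⟪α, c⟫_ℝ}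

theorem openChamber_subset (R : Set F) : openChamber R ⊆ chamber R :=
  fun _ h α hα => (h α hα).le

namespace IsPositiveSystem

variable {R : Set F} {x₀ : F} (hR : IsPositiveSystem R x₀)
include hR

theorem neg_notMem {α : F} (hα : α ∈ R) : -α ∉ R := by
  intro h
  have h1 := hR.pos _ hα
  have h2 := hR.pos _ h
  rw [inner_neg_left] at h2
  linarith

theorem mem_or_neg_mem {g : F ≃ₗᵢ[ℝ] F} (hg : g ∈ rootGroup R) :
    ∀ β ∈ R, g β ∈ R ∨ -g β ∈ R := by
  induction hg using Subgroup.closure_induction'' with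
  | one => exact fun β hβ => Or.inl hβ
  | mem x hx =>
    obtain ⟨α, hα, rfl⟩ := hx
    exact hR.refl_mem α hα
  | inv_mem x hx =>
    obtain ⟨α, hα, rfl⟩ := hx
    rw [rootRefl_inv]
    exact hR.refl_mem α hα
  | mul x y _ _ hx hy =>
    intro β hβ
    rw [linearIsometryEquiv_mul_apply]
    rcases hy β hβ with h | h
    · exact hx _ h
    · have := hx _ h
      rw [map_neg, neg_neg] at this
      exact this.symm

/-- The reflections in simple roots generate all reflections. -/
theorem rootRefl_mem_closure_simple :
    ∀ β ∈ R, rootRefl β ∈ Subgroup.closure (rootRefl '' {α | IsSimpleRoot R α}) := by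
  set S := Subgroup.closure (rootRefl '' {α | IsSimpleRoot R α})
  -- Induction on the height `⟪β, x₀⟫`, which takes finitely many values on `R`.
  have hwf : R.WellFoundedOn (InvImage (· < ·) fun β => ⟪β, x₀⟫_ℝ) := by
    have : IsStrictOrder F (InvImage (· < ·) fun β => ⟪β, x₀⟫_ℝ) :=
      { irrefl := fun a h => lt_irrefl _ h, trans := fun a b c h h' => lt_trans h h' }
    exact hR.finite.wellFoundedOn
  intro β hβ
  refine hwf.induction (P := fun β => rootRefl β ∈ S) hβ fun β hβ ih => ?_
  change ∀ η ∈ R, ⟪η, x₀⟫_ℝ < ⟪β, x₀⟫_ℝ → rootRefl η ∈ S at ih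
  by_cases hs : IsSimpleRoot R β
  · exact Subgroup.subset_closure ⟨β, hs, rfl⟩
  have hβ1 := hR.norm_eq_one β hβ
  -- Put `t = ⟪β, δ⟫`. The height of `δ` is at most `t` times that of `β`, and `0 < t < 1`. So `δ`
  -- is lower than `β`, and so is the positive one of `± rootRefl δ β`; the reflection in `β` is a
  -- conjugate of the latter's by that in `δ`.
  have key : ∀ δ ∈ R, δ ≠ β → 2 * ⟪β, δ⟫_ℝ * ⟪β, x₀⟫_ℝ ≥ 2 * ⟪δ, x₀⟫_ℝ → rootRefl β ∈ S := by
    intro δ hδ hne hle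
    have hδ1 := hR.norm_eq_one δ hδ
    have ht : ⟪β, δ⟫_ℝ < 1 := (inner_lt_one_iff_real_of_norm_eq_one hβ1 hδ1).2 hne.symm
    have hhβ := hR.pos β hβ
    have hhδ := hR.pos δ hδ
    have ht0 : 0 < ⟪β, δ⟫_ℝ := by
      by_contra h
      push Not at h
      nlinarith
    have hδβ : ⟪δ, x₀⟫_ℝ < ⟪β, x₀⟫_ℝ := by nlinarith
    have hconj : rootRefl β = rootRefl δ * rootRefl (rootRefl δ β) * rootRefl δ := by
      rw [rootRefl_map hβ1, rootRefl_inv, ← mul_assoc, ← mul_assoc, rootRefl_mul_self, one_mul,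
        mul_assoc, rootRefl_mul_self, mul_one]
    have hval : ⟪rootRefl δ β, x₀⟫_ℝ = ⟪β, x₀⟫_ℝ - 2 * ⟪β, δ⟫_ℝ * ⟪δ, x₀⟫_ℝ := by
      rw [rootRefl_apply hδ1, inner_sub_left, real_inner_smul_left, real_inner_comm β δ]
    have hmem : rootRefl (rootRefl δ β) ∈ S := by
      rcases hR.refl_mem δ hδ β hβ with h | h
      · refine ih _ h ?_
        rw [hval]
        nlinarith [mul_pos ht0 hhδ]
      · rw [← rootRefl_neg]
        refine ih _ h ?_
        rw [inner_neg_left, hval]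
        nlinarith [mul_pos ht0 hhδ]
    rw [hconj]
    exact S.mul_mem (S.mul_mem (ih δ hδ hδβ) hmem) (ih δ hδ hδβ)
  have hns : ∃ δ ∈ R, δ ≠ β ∧ rootRefl β δ ∉ R := by
    by_contra h
    push Not at h
    exact hs ⟨hβ, h⟩
  obtain ⟨δ, hδ, hne, hnot⟩ := hns
  have hε := (hR.refl_mem β hβ δ hδ).resolve_left hnot
  have hεval : ⟪-rootRefl β δ, x₀⟫_ℝ = 2 * ⟪β, δ⟫_ℝ * ⟪β, x₀⟫_ℝ - ⟪δ, x₀⟫_ℝ := by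
    rw [rootRefl_apply hβ1, inner_neg_left, inner_sub_left, real_inner_smul_left]
    ring
  have hβε : ⟪β, -rootRefl β δ⟫_ℝ = ⟪β, δ⟫_ℝ := by
    rw [rootRefl_apply hβ1, inner_neg_right, inner_sub_right, real_inner_smul_right,
      real_inner_self_eq_norm_sq, hβ1]
    ring
  have hεne : -rootRefl β δ ≠ β := by
    intro h
    apply hne
    have h1 : rootRefl β δ = rootRefl β β := by
      rw [rootRefl_self, ← h, neg_neg]
      rw [h]
    exact (rootRefl β).injective h1
  -- `δ` and `-rootRefl β δ` add up to `2 * ⟪β, δ⟫` times `β`, so the lower of the two meets the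
  -- bound in `key`.
  rcases le_total ⟪δ, x₀⟫_ℝ ⟪-rootRefl β δ, x₀⟫_ℝ with h | h
  · exact key δ hδ hne (by rw [hεval] at h; linarith)
  · refine key _ hε hεne ?_
    rw [hβε]
    rw [hεval] at h ⊢
    linarith

theorem closure_simple : Subgroup.closure (rootRefl '' {α | IsSimpleRoot R α}) = rootGroup R := by
  apply le_antisymm
  · exact Subgroup.closure_mono (Set.image_mono fun α h => h.1)
  · rw [rootGroup, Subgroup.closure_le]
    rintro _ ⟨β, hβ, rfl⟩
    exact hR.rootRefl_mem_closure_simple β hβ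

omit hR in
theorem exists_list_of_mem_closure_simple {g : F ≃ₗᵢ[ℝ] F}
    (hg : g ∈ Subgroup.closure (rootRefl '' {α | IsSimpleRoot R α})) :
    ∃ L : List F, (∀ α ∈ L, IsSimpleRoot R α) ∧ g = (L.map rootRefl).prod := by
  induction hg using Subgroup.closure_induction'' with
  | one => exact ⟨[], by simp, by simp⟩
  | mem x hx =>
    obtain ⟨α, hα, rfl⟩ := hx
    exact ⟨[α], by simpa using hα, by simp⟩
  | inv_mem x hx =>
    obtain ⟨α, hα, rfl⟩ := hx
    exact ⟨[α], by simpa using hα, by simp [rootRefl_inv]⟩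
  | mul x y _ _ hx hy =>
    obtain ⟨L, hL, rfl⟩ := hx
    obtain ⟨M, hM, rfl⟩ := hy
    refine ⟨L ++ M, fun α hα => ?_, by simp⟩
    rcases List.mem_append.1 hα with h | h
    · exact hL α h
    · exact hM α h

omit hR in
theorem list_prod_mem {L : List F} (hL : ∀ α ∈ L, IsSimpleRoot R α) :
    (L.map rootRefl).prod ∈ rootGroup R := by
  refine Subgroup.list_prod_mem _ fun x hx => ?_
  obtain ⟨α, hα, rfl⟩ := List.mem_map.1 hx
  exact Subgroup.subset_closure ⟨α, (hL α hα).1, rfl⟩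

/-- The exchange condition. -/
theorem exchange (L : List F) (hL : ∀ α ∈ L, IsSimpleRoot R α) {β : F} (hβ : IsSimpleRoot R β)
    (h : -(L.map rootRefl).prod β ∈ R) :
    ∃ M : List F, (∀ α ∈ M, IsSimpleRoot R α) ∧ M.length + 1 = L.length ∧
      (L.map rootRefl).prod = (M.map rootRefl).prod * rootRefl β := by
  induction L with
  | nil => exact absurd (by simpa using h) (hR.neg_notMem hβ.1)
  | cons a L ih =>
    have hL' : ∀ α ∈ L, IsSimpleRoot R α := fun α hα => hL α (List.mem_cons_of_mem _ hα)
    have ha : IsSimpleRoot R a := hL a List.mem_cons_self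
    rw [List.map_cons, List.prod_cons, linearIsometryEquiv_mul_apply] at h
    rcases hR.mem_or_neg_mem (list_prod_mem hL') β hβ.1 with hp | hn
    · have heq : (L.map rootRefl).prod β = a := by
        by_contra hne
        exact hR.neg_notMem (ha.2 _ hp hne) h
      refine ⟨L, hL', by simp, ?_⟩
      rw [List.map_cons, List.prod_cons, ← heq, rootRefl_map (hR.norm_eq_one β hβ.1),
        inv_mul_cancel_right]
    · obtain ⟨M, hM, hlen, hprod⟩ := ih hL' hn
      refine ⟨a :: M, ?_, by simp [hlen], ?_⟩
      · intro α hα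
        rcases List.mem_cons.1 hα with rfl | h'
        · exact ha
        · exact hM α h'
      · rw [List.map_cons, List.prod_cons, List.map_cons, List.prod_cons, hprod, mul_assoc]

/-- If the last letter is `β`, the rest of the word makes `β` negative. By exchange the rest can be
rewritten to end in `rootRefl β`, which cancels the last letter. The word shrinks by two letters,
hence the induction on a bound for the length. -/
theorem list_prod_eq_one (n : ℕ) : ∀ L : List F, L.length ≤ n → (∀ α ∈ L, IsSimpleRoot R α) →
    (∀ β ∈ R, (L.map rootRefl).prod β ∈ R) → (L.map rootRefl).prod = 1 := by
  induction n with
  | zero =>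
    intro L hlen _ _
    rw [List.length_eq_zero_iff.1 (Nat.le_zero.1 hlen)]
    simp
  | succ n ih =>
    intro L hlen hL h
    rcases L.eq_nil_or_concat with rfl | ⟨L, β, rfl⟩
    · simp
    rw [List.concat_eq_append] at *
    have hβ : IsSimpleRoot R β := hL β (by simp)
    have hL' : ∀ α ∈ L, IsSimpleRoot R α := fun α hα => hL α (by simp [hα])
    have hprod : ((L ++ [β]).map rootRefl).prod = (L.map rootRefl).prod * rootRefl β := by simp
    have h1 := h β hβ.1
    rw [hprod, linearIsometryEquiv_mul_apply, rootRefl_self, map_neg] at h1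
    obtain ⟨M, hM, hMlen, hMprod⟩ := hR.exchange L hL' hβ h1
    have h2 : ((L ++ [β]).map rootRefl).prod = (M.map rootRefl).prod := by
      rw [hprod, hMprod, mul_assoc, rootRefl_mul_self, mul_one]
    rw [h2] at h ⊢
    refine ih M ?_ hM h
    rw [List.length_append, List.length_singleton] at hlen
    lia

theorem eq_one_of_forall_mem {g : F ≃ₗᵢ[ℝ] F} (hg : g ∈ rootGroup R) (h : ∀ β ∈ R, g β ∈ R) :
    g = 1 := by
  rw [← hR.closure_simple] at hg
  obtain ⟨L, hL, rfl⟩ := exists_list_of_mem_closure_simple hg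
  exact hR.list_prod_eq_one _ L le_rfl hL h

/-- An element of the group that maps a point of the open chamber into the chamber is trivial. -/
theorem eq_one_of_apply_mem_chamber {g : F ≃ₗᵢ[ℝ] F} (hg : g ∈ rootGroup R) {x : F}
    (hx : x ∈ openChamber R) (hgx : g x ∈ chamber R) : g = 1 := by
  rw [← inv_eq_one]
  have hg' := inv_mem hg
  refine hR.eq_one_of_forall_mem hg' fun β hβ => ?_
  refine (hR.mem_or_neg_mem hg' β hβ).resolve_right fun h => ?_
  have h1 := hx _ h
  rw [inner_neg_left, inner_symm_apply] at h1
  have h2 := hgx β hβ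
  linarith

/-- If `g x` were on the negative side of some root, reflecting it in that root would increase `⟪c,
·⟫`. So `g x` lies in the chamber. -/
theorem eq_one_of_isMax {c x : F} (hc : c ∈ openChamber R) (hx : x ∈ openChamber R)
    {g : F ≃ₗᵢ[ℝ] F} (hg : g ∈ rootGroup R)
    (hmax : ∀ h ∈ rootGroup R, ⟪c, h x⟫_ℝ ≤ ⟪c, g x⟫_ℝ) : g = 1 := by
  refine hR.eq_one_of_apply_mem_chamber hg hx fun α hα => ?_
  by_contra hneg
  push Not at hneg
  have h1 := hmax (rootRefl α * g) (mul_mem (Subgroup.subset_closure ⟨α, hα, rfl⟩) hg)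
  rw [linearIsometryEquiv_mul_apply, rootRefl_apply (hR.norm_eq_one α hα), inner_sub_right,
    real_inner_smul_right, real_inner_comm α c] at h1
  nlinarith [hc α hα]

theorem inner_apply_lt [Finite (rootGroup R)] {c x : F} (hc : c ∈ openChamber R)
    (hx : x ∈ openChamber R) {g : F ≃ₗᵢ[ℝ] F} (hg : g ∈ rootGroup R) (hg1 : g ≠ 1) :
    ⟪c, g x⟫_ℝ < ⟪c, x⟫_ℝ := by
  obtain ⟨⟨g₀, hg₀⟩, hmax⟩ := Finite.exists_max fun h : rootGroup R => ⟪c, h.1 x⟫_ℝ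
  have hmax' : ∀ h ∈ rootGroup R, ⟪c, h x⟫_ℝ ≤ ⟪c, g₀ x⟫_ℝ := fun h hh => hmax ⟨h, hh⟩
  have h0 := hR.eq_one_of_isMax hc hx hg₀ hmax'
  subst h0
  by_contra hle
  push Not at hle
  exact hg1 (hR.eq_one_of_isMax hc hx hg fun h hh => (hmax' h hh).trans hle)

theorem inner_apply_le [Finite (rootGroup R)] {c x : F} (hc : c ∈ chamber R)
    (hx : x ∈ openChamber R) {g : F ≃ₗᵢ[ℝ] F} (hg : g ∈ rootGroup R) :
    ⟪c, g x⟫_ℝ ≤ ⟪c, x⟫_ℝ := by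
  rcases eq_or_ne g 1 with rfl | hg1
  · rfl
  -- Push `c` into the open chamber along `x`, then let `ε` tend to `0`.
  have hε : ∀ ε : ℝ, 0 < ε → ⟪c, g x⟫_ℝ + ε * ⟪x, g x⟫_ℝ ≤ ⟪c, x⟫_ℝ + ε * ⟪x, x⟫_ℝ := by
    intro ε hε
    have hmem : c + ε • x ∈ openChamber R := by
      intro α hα
      rw [inner_add_right, real_inner_smul_right]
      have := mul_pos hε (hx α hα)
      have := hc α hα
      linarith
    have := hR.inner_apply_lt hmem hx hg hg1
    simp only [inner_add_left, real_inner_smul_left] at this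
    exact this.le
  have h1 : Filter.Tendsto (fun ε : ℝ => ⟪c, g x⟫_ℝ + ε * ⟪x, g x⟫_ℝ)
      (nhdsWithin 0 (Set.Ioi 0)) (nhds ⟪c, g x⟫_ℝ) := by
    have : Continuous fun ε : ℝ => ⟪c, g x⟫_ℝ + ε * ⟪x, g x⟫_ℝ := by fun_prop
    simpa using (this.tendsto 0).mono_left nhdsWithin_le_nhds
  have h2 : Filter.Tendsto (fun ε : ℝ => ⟪c, x⟫_ℝ + ε * ⟪x, x⟫_ℝ)
      (nhdsWithin 0 (Set.Ioi 0)) (nhds ⟪c, x⟫_ℝ) := by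
    have : Continuous fun ε : ℝ => ⟪c, x⟫_ℝ + ε * ⟪x, x⟫_ℝ := by fun_prop
    simpa only [zero_mul, add_zero] using (this.tendsto 0).mono_left nhdsWithin_le_nhds
  exact le_of_tendsto_of_tendsto h1 h2
    (Filter.eventually_of_mem self_mem_nhdsWithin fun ε h => hε ε h)

end IsPositiveSystem

end PositiveSystem

end Symmetrization

namespace Symmetrization

open Filter Topology

/-! ### The orbit polytope: normal cones, vertices and edges. -/

section Orbit

variable {F : Type*} [NormedAddCommGroup F] [InnerProductSpace ℝ F]

/-- The convex hull of the orbit of `P` under the group of the roots `R`. -/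
def orbitHull (R P : Set F) : Set F := convexHull ℝ {y | ∃ g ∈ rootGroup R, ∃ x ∈ P, y = g x}

theorem apply_mem_orbitHull {R P : Set F} {g : F ≃ₗᵢ[ℝ] F} (hg : g ∈ rootGroup R) {x : F}
    (hx : x ∈ P) : g x ∈ orbitHull R P :=
  subset_convexHull ℝ _ ⟨g, hg, x, hx, rfl⟩

theorem subset_orbitHull (R P : Set F) : P ⊆ orbitHull R P :=
  fun _ hx => apply_mem_orbitHull (one_mem _) hx

theorem apply_mem_orbitHull_of_mem {R P : Set F} {g : F ≃ₗᵢ[ℝ] F} (hg : g ∈ rootGroup R) {y : F}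
    (hy : y ∈ orbitHull R P) : g y ∈ orbitHull R P := by
  have h1 : g y ∈ (g.toLinearEquiv : F →ₗ[ℝ] F) '' orbitHull R P := ⟨y, hy, rfl⟩
  rw [orbitHull, LinearMap.image_convexHull] at h1
  refine convexHull_mono ?_ h1
  rintro _ ⟨_, ⟨h, hh, x, hx, rfl⟩, rfl⟩
  exact ⟨g * h, mul_mem hg hh, x, hx, rfl⟩

theorem isPolytope_orbitHull {R P : Set F} [Finite (rootGroup R)] (hP : IsPolytope P) :
    IsPolytope (orbitHull R P) := by
  obtain ⟨s, hs, rfl⟩ := hP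
  refine ⟨(fun p : rootGroup R × F => p.1.1 p.2) '' (Set.univ ×ˢ s),
    (Set.finite_univ.prod hs).image _, Set.Subset.antisymm ?_ ?_⟩
  · refine convexHull_min ?_ (convex_convexHull ℝ _)
    rintro _ ⟨g, hg, x, hx, rfl⟩
    have h1 : g x ∈ (g.toLinearEquiv : F →ₗ[ℝ] F) '' convexHull ℝ s := ⟨x, hx, rfl⟩
    rw [LinearMap.image_convexHull] at h1
    refine convexHull_mono ?_ h1
    rintro _ ⟨y, hy, rfl⟩
    exact ⟨(⟨g, hg⟩, y), ⟨trivial, hy⟩, rfl⟩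
  · refine convexHull_mono ?_
    rintro _ ⟨⟨g, y⟩, ⟨-, hy⟩, rfl⟩
    exact ⟨g.1, g.2, y, subset_convexHull ℝ s hy, rfl⟩

theorem maxFace_apply_image {Q : Set F} {g : F ≃ₗᵢ[ℝ] F} (h : ∀ y ∈ Q, g y ∈ Q)
    (h' : ∀ y ∈ Q, g⁻¹ y ∈ Q) (c : F) : g '' maxFace Q c = maxFace Q (g c) := by
  have key : ∀ x, ⟪g c, x⟫_ℝ = ⟪c, g⁻¹ x⟫_ℝ := fun x => by
    rw [real_inner_comm, ← inner_symm_apply, real_inner_comm]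
  ext x
  constructor
  · rintro ⟨x, hx, rfl⟩
    refine ⟨h x hx.1, fun y hy => ?_⟩
    rw [g.inner_map_map, key]
    exact hx.2 _ (h' y hy)
  · intro hx
    refine ⟨g⁻¹ x, ⟨h' x hx.1, fun y hy => ?_⟩, g.apply_symm_apply x⟩
    have := hx.2 _ (h y hy)
    rwa [g.inner_map_map, key] at this

theorem dimSet_image {X Y : Type*} [AddCommGroup X] [Module ℝ X] [AddCommGroup Y] [Module ℝ Y]
    (f : X →ᵃ[ℝ] Y) (hf : Function.Injective f) (A : Set X) : dimSet (f '' A) = dimSet A := by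
  rw [dimSet, dimSet, ← AffineMap.map_vectorSpan]
  exact (Submodule.equivMapOfInjective _ (f.linear_injective_iff.2 hf) _).finrank_eq.symm

theorem isFace_apply_image [FiniteDimensional ℝ F] {R P A : Set F} {g : F ≃ₗᵢ[ℝ] F}
    (hg : g ∈ rootGroup R) (hA : IsFace (orbitHull R P) A) :
    IsFace (orbitHull R P) (g '' A) := by
  obtain ⟨hn, c, rfl⟩ := isFace_iff.1 hA
  exact isFace_iff.2 ⟨hn.image _, g c, maxFace_apply_image
    (fun y hy => apply_mem_orbitHull_of_mem hg hy)
    (fun y hy => apply_mem_orbitHull_of_mem (inv_mem hg) hy) c⟩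

theorem isFace_inter_of_subset [FiniteDimensional ℝ F] {P Q A : Set F} (hPQ : P ⊆ Q)
    (hA : IsFace Q A) (hn : (A ∩ P).Nonempty) : IsFace P (A ∩ P) := by
  obtain ⟨-, c, rfl⟩ := isFace_iff.1 hA
  refine isFace_iff.2 ⟨hn, c, ?_⟩
  ext x
  constructor
  · exact fun hx => ⟨hx.2, fun y hy => hx.1.2 y (hPQ hy)⟩
  · obtain ⟨z, hz⟩ := hn
    exact fun hx => ⟨⟨hPQ hx.1, fun y hy => (hz.1.2 y hy).trans (hx.2 z hz.2)⟩, hx.1⟩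

theorem fNum_zero_eq (Q : Set F) [FiniteDimensional ℝ F] :
    fNum Q 0 = {x | IsFace Q {x}}.ncard := by
  rw [← Set.ncard_image_of_injective _ Set.singleton_injective, fNum]
  congr 1
  ext A
  constructor
  · rintro ⟨hA, hd⟩
    obtain ⟨x, hx⟩ := hA.2
    have := (dimSet_eq_zero_iff.1 hd).eq_singleton_of_mem hx
    subst this
    exact ⟨x, hA, rfl⟩
  · rintro ⟨x, hx, rfl⟩
    exact ⟨hx, dimSet_eq_zero_iff.2 Set.subsingleton_singleton⟩

namespace IsPositiveSystem

variable {R P : Set F} {x₀ γ : F} [Finite (rootGroup R)] (hR : IsPositiveSystem R x₀)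
  (hPR : P ⊆ openChamber R)
include hR hPR

theorem inner_le_of_mem_orbitHull {c : F} (hc : c ∈ chamber R) {r : ℝ}
    (h : ∀ x ∈ P, ⟪c, x⟫_ℝ ≤ r) : ∀ y ∈ orbitHull R P, ⟪c, y⟫_ℝ ≤ r := by
  intro y hy
  refine inner_le_of_mem_convexHull hy ?_
  rintro _ ⟨g, hg, x, hx, rfl⟩
  exact (hR.inner_apply_le hc (hPR hx) hg).trans (h x hx)

/-- Comparing a point of `S` with its mirror image in each root forces `c` into the chamber.
Conversely, a `c` in the chamber cannot gain by moving a point of `P` along its orbit. -/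
theorem normalCone_orbitHull {S : Set F} (hS : S ⊆ P) (hSn : S.Nonempty) :
    normalCone S (orbitHull R P) = normalCone S P ∩ chamber R := by
  ext c
  constructor
  · intro hc
    refine ⟨fun y hy y' hy' => hc y hy y' (subset_orbitHull R P hy'), fun α hα => ?_⟩
    obtain ⟨s, hs⟩ := hSn
    have h1 := hc s hs _ (apply_mem_orbitHull
      (Subgroup.subset_closure ⟨α, hα, rfl⟩ : rootRefl α ∈ rootGroup R) (hS hs))
    rw [rootRefl_apply (hR.norm_eq_one α hα), inner_sub_right, real_inner_smul_right,
      real_inner_comm α c] at h1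
    have h2 := hPR (hS hs) α hα
    by_contra hneg
    push Not at hneg
    nlinarith
  · rintro ⟨hc, hcC⟩ y hy
    exact hR.inner_le_of_mem_orbitHull hPR hcC (hc y hy)

theorem maxFace_orbitHull [FiniteDimensional ℝ F] (hP : IsPolytope P) {c : F}
    (hc : c ∈ openChamber R) : maxFace (orbitHull R P) c = maxFace P c := by
  have hQ := isPolytope_orbitHull (R := R) hP
  have hsub : maxFace (orbitHull R P) c ⊆ P := by
    rcases (maxFace (orbitHull R P) c).eq_empty_or_nonempty with h | hn
    · rw [h]; exact Set.empty_subset _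
    have hA : IsFace (orbitHull R P) (maxFace (orbitHull R P) c) := isFace_iff.2 ⟨hn, c, rfl⟩
    -- It suffices that the extreme points lie in `P`. Each is some `g x` with `x ∈ P`, and the
    -- strict inequality excludes `g ≠ 1`.
    rw [← closure_convexHull_extremePoints (hQ.isCompact_face hA) (hQ.convex_face hA)]
    refine closure_minimal (convexHull_min ?_ hP.convex) hP.isCompact.isClosed
    intro y hy
    obtain ⟨g, hg, x, hx, rfl⟩ := extremePoints_convexHull_subset
      (hA.1.isExtreme.extremePoints_subset_extremePoints hy)
    rcases eq_or_ne g 1 with rfl | hg1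
    · exact hx
    · have h1 := hR.inner_apply_lt hc (hPR hx) hg hg1
      have h2 := hy.1.2 x (subset_orbitHull R P hx)
      exact absurd h1 (not_lt.2 h2)
  ext x
  constructor
  · exact fun hx => ⟨hsub hx, fun y hy => hx.2 y (subset_orbitHull R P hy)⟩
  · exact fun hx => ⟨subset_orbitHull R P hx.1,
      hR.inner_le_of_mem_orbitHull hPR (openChamber_subset R hc) hx.2⟩

/-- If `w` exposes `A` in `P`, so does `γ + ε • w`, because `γ` is constant on `P`. For small `ε`
this vector is in the open chamber, where `P` and its orbit hull have the same maximizers. -/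
theorem isFace_orbitHull_of_isFace [FiniteDimensional ℝ F] (hP : IsPolytope P)
    (hγ : γ ∈ openChamber R) (hconst : ∀ x ∈ P, ∀ y ∈ P, ⟪γ, x⟫_ℝ = ⟪γ, y⟫_ℝ) {A : Set F}
    (hA : IsFace P A) : IsFace (orbitHull R P) A := by
  obtain ⟨hn, w, rfl⟩ := isFace_iff.1 hA
  have h1 : ∀ᶠ ε : ℝ in 𝓝[>] 0, γ + ε • w ∈ openChamber R := by
    have : ∀ α ∈ R, ∀ᶠ ε : ℝ in 𝓝[>] 0, 0 < ⟪α, γ + ε • w⟫_ℝ := by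
      intro α hα
      have : ∀ᶠ ε : ℝ in 𝓝 0, 0 < ⟪α, γ + ε • w⟫_ℝ := by
        apply ContinuousAt.eventually_lt
        · fun_prop
        · fun_prop
        · simpa using hγ α hα
      exact this.filter_mono nhdsWithin_le_nhds
    exact (eventually_all_finite hR.finite).2 this
  obtain ⟨ε, hε, h2⟩ := (h1.and (hP.maxFace_add_smul γ w)).exists
  have h3 : maxFace P γ = P := Set.Subset.antisymm (maxFace_subset _ _)
    fun x hx => ⟨hx, fun y hy => (hconst y hy x hx).le⟩
  rw [h3] at h2
  exact isFace_iff.2 ⟨hn, γ + ε • w, by rw [hR.maxFace_orbitHull hPR hP hε, h2]⟩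

omit [Finite (rootGroup R)] in
theorem eq_and_eq_of_apply_eq {g h : F ≃ₗᵢ[ℝ] F} (hg : g ∈ rootGroup R) (hh : h ∈ rootGroup R)
    {x y : F} (hx : x ∈ P) (hy : y ∈ P) (hxy : g x = h y) : g = h ∧ x = y := by
  have h1 : (h⁻¹ * g) x = y := by
    rw [linearIsometryEquiv_mul_apply, hxy]
    exact h.symm_apply_apply y
  have h2 := hR.eq_one_of_apply_mem_chamber (mul_mem (inv_mem hh) hg) (hPR hx)
    (h1 ▸ openChamber_subset R (hPR hy))
  refine ⟨(inv_mul_eq_one.1 h2).symm, ?_⟩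
  rw [h2] at h1
  exact h1

omit hR hPR [Finite (rootGroup R)] in
theorem exists_of_isFace_singleton [FiniteDimensional ℝ F] {x : F}
    (hx : IsFace (orbitHull R P) {x}) :
    ∃ g ∈ rootGroup R, ∃ v ∈ P, IsFace (orbitHull R P) {v} ∧ x = g v := by
  have hext : x ∈ (orbitHull R P).extremePoints ℝ :=
    hx.1.isExtreme.extremePoints_subset_extremePoints (by simp)
  obtain ⟨g, hg, v, hv, rfl⟩ := extremePoints_convexHull_subset hext
  refine ⟨g, hg, v, hv, ?_, rfl⟩
  have := isFace_apply_image (inv_mem hg) hx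
  rw [Set.image_singleton] at this
  rwa [show g⁻¹ (g v) = v from g.symm_apply_apply v] at this

theorem isFace_orbitHull_iff [FiniteDimensional ℝ F] (hP : IsPolytope P)
    (hγ : γ ∈ openChamber R) (hconst : ∀ x ∈ P, ∀ y ∈ P, ⟪γ, x⟫_ℝ = ⟪γ, y⟫_ℝ) {A : Set F} :
    IsFace P A ↔ IsFace (orbitHull R P) A ∧ A ⊆ P := by
  refine ⟨fun h => ⟨hR.isFace_orbitHull_of_isFace hPR hP hγ hconst h, h.subset⟩, fun h => ?_⟩
  have hAP : A ∩ P = A := Set.inter_eq_left.2 h.2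
  have := isFace_inter_of_subset (subset_orbitHull R P) h.1 (hAP.symm ▸ h.1.2)
  rwa [hAP] at this

theorem fNum_orbitHull_zero [FiniteDimensional ℝ F] (hP : IsPolytope P)
    (hγ : γ ∈ openChamber R) (hconst : ∀ x ∈ P, ∀ y ∈ P, ⟪γ, x⟫_ℝ = ⟪γ, y⟫_ℝ) :
    fNum (orbitHull R P) 0 = Nat.card (rootGroup R) * fNum P 0 := by
  rw [fNum_zero_eq, fNum_zero_eq, ← Set.ncard_univ, ← Set.ncard_prod]
  have hinj : Set.InjOn (fun p : rootGroup R × F => p.1.1 p.2)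
      (Set.univ ×ˢ {x | IsFace P {x}}) := by
    rintro ⟨⟨g, hg⟩, x⟩ ⟨-, hx⟩ ⟨⟨h, hh⟩, y⟩ ⟨-, hy⟩ hxy
    obtain ⟨rfl, rfl⟩ := hR.eq_and_eq_of_apply_eq hPR hg hh (hx.subset rfl) (hy.subset rfl) hxy
    rfl
  rw [← hinj.ncard_image]
  congr 1
  ext x
  constructor
  · intro hx
    obtain ⟨g, hg, v, hv, hvf, rfl⟩ := exists_of_isFace_singleton hx
    exact ⟨(⟨g, hg⟩, v), ⟨trivial, (hR.isFace_orbitHull_iff hPR hP hγ hconst).2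
      ⟨hvf, Set.singleton_subset_iff.2 hv⟩⟩, rfl⟩
  · rintro ⟨⟨⟨g, hg⟩, v⟩, ⟨-, hv⟩, rfl⟩
    have := isFace_apply_image hg ((hR.isFace_orbitHull_iff hPR hP hγ hconst).1 hv).1
    rwa [Set.image_singleton] at this

-- If `A` meets `P`, the intersection is a face of `P`; it has a vertex, which is a vertex of the
-- orbit hull and so an endpoint of `A`. The endpoints are named so that `a` is in `P` whenever
-- either is.
omit hPR hR in
theorem exists_endpoints [FiniteDimensional ℝ F] (hP : IsPolytope P) (hR : IsPositiveSystem R x₀)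
    (hPR : P ⊆ openChamber R)
    (hγ : γ ∈ openChamber R) (hconst : ∀ x ∈ P, ∀ y ∈ P, ⟪γ, x⟫_ℝ = ⟪γ, y⟫_ℝ) {A : Set F}
    (hA : IsFace (orbitHull R P) A) (hd : dimSet A = 1) :
    ∃ a b, a ≠ b ∧ (∀ x, (x ∈ A ∧ IsFace (orbitHull R P) {x}) ↔ x = a ∨ x = b) ∧
      ((A ∩ P).Nonempty ↔ a ∈ P) ∧ (A ⊆ P ↔ b ∈ P) := by
  have hQ := isPolytope_orbitHull (R := R) hP
  obtain ⟨a, b, hab, ha, hb, haA, hbA, hseg, honly⟩ := hQ.exists_segment_of_dimSet_eq_one hA hd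
  have hchar : ∀ x, (x ∈ A ∧ IsFace (orbitHull R P) {x}) ↔ x = a ∨ x = b := by
    refine fun x => ⟨fun h => honly x h.1 h.2, ?_⟩
    rintro (rfl | rfl)
    · exact ⟨haA, ha⟩
    · exact ⟨hbA, hb⟩
  have hmeet : (A ∩ P).Nonempty → a ∈ P ∨ b ∈ P := by
    intro hn
    obtain ⟨x, hx, hxf⟩ := hP.exists_vertex (isFace_inter_of_subset (subset_orbitHull R P) hA hn)
    rcases honly x hx.1 (hR.isFace_orbitHull_of_isFace hPR hP hγ hconst hxf) with rfl | rfl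
    · exact Or.inl hx.2
    · exact Or.inr hx.2
  have hboth : a ∈ P → b ∈ P → A ⊆ P := fun h1 h2 =>
    hseg.trans (hP.convex.segment_subset h1 h2)
  by_cases haP : a ∈ P
  · exact ⟨a, b, hab, hchar, ⟨fun _ => haP, fun _ => ⟨a, haA, haP⟩⟩, fun h => h hbA, hboth haP⟩
  · refine ⟨b, a, hab.symm, fun x => (hchar x).trans or_comm,
      ⟨fun h => (hmeet h).resolve_left haP, fun h => ⟨b, hbA, h⟩⟩, fun h => h haA,
      fun h => absurd h haP⟩

/-- Double counting of flags, that is, pairs of an edge and a vertex on it. -/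
theorem two_mul_fNum_orbitHull_one [FiniteDimensional ℝ F] (hP : IsPolytope P)
    (hγ : γ ∈ openChamber R) (hconst : ∀ x ∈ P, ∀ y ∈ P, ⟪γ, x⟫_ℝ = ⟪γ, y⟫_ℝ) :
    2 * fNum (orbitHull R P) 1 = Nat.card (rootGroup R) *
      ({A | (IsFace (orbitHull R P) A ∧ dimSet A = 1) ∧ (A ∩ P).Nonempty}.ncard + fNum P 1) := by
  set Q := orbitHull R P
  have hQ : IsPolytope Q := isPolytope_orbitHull hP
  set Ed := {A | IsFace Q A ∧ dimSet A = 1} with hEd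
  have hfin : Ed.Finite := hQ.finite_faces.subset fun A h => h.1
  have hends := fun A (hA : A ∈ Ed) =>
    exists_endpoints hP hR hPR hγ hconst hA.1 hA.2
  choose! a b hab hchar hmeet hsub using hends
  have hcount : ∀ S T : Set (Set F), S ⊆ Ed → T ⊆ Ed →
      ((fun A => (A, a A)) '' S ∪ (fun A => (A, b A)) '' T).ncard = S.ncard + T.ncard := by
    intro S T hS hT
    rw [Set.ncard_union_eq ?_ ((hfin.subset hS).image _) ((hfin.subset hT).image _),
      Set.ncard_image_of_injective _ fun A B h => congrArg Prod.fst h,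
      Set.ncard_image_of_injective _ fun A B h => congrArg Prod.fst h]
    rw [Set.disjoint_left]
    rintro _ ⟨A, hA, rfl⟩ ⟨B, hB, hBA⟩
    obtain ⟨rfl, h⟩ := Prod.mk.inj hBA
    exact hab B (hS hA) h.symm
  have hflags : {p : Set F × F | p.1 ∈ Ed ∧ p.2 ∈ p.1 ∧ IsFace Q {p.2}} =
      (fun A => (A, a A)) '' Ed ∪ (fun A => (A, b A)) '' Ed := by
    ext ⟨A, x⟩
    constructor
    · rintro ⟨hA, hx⟩
      rcases (hchar A hA x).1 hx with h | h
      · exact Or.inl ⟨A, hA, by simp [h]⟩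
      · exact Or.inr ⟨A, hA, by simp [h]⟩
    · rintro (⟨A, hA, h⟩ | ⟨A, hA, h⟩) <;> obtain ⟨rfl, rfl⟩ := Prod.mk.inj h
      · exact ⟨hA, (hchar A hA _).2 (Or.inl rfl)⟩
      · exact ⟨hA, (hchar A hA _).2 (Or.inr rfl)⟩
  have hflagsP : {p : Set F × F | p.1 ∈ Ed ∧ p.2 ∈ p.1 ∧ IsFace Q {p.2} ∧ p.2 ∈ P} =
      (fun A => (A, a A)) '' {A | A ∈ Ed ∧ (A ∩ P).Nonempty} ∪
        (fun A => (A, b A)) '' {A | A ∈ Ed ∧ A ⊆ P} := by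
    ext ⟨A, x⟩
    constructor
    · rintro ⟨hA, hx, hxf, hxP⟩
      rcases (hchar A hA x).1 ⟨hx, hxf⟩ with h | h
      · exact Or.inl ⟨A, ⟨hA, (hmeet A hA).2 (h ▸ hxP)⟩, by simp [h]⟩
      · exact Or.inr ⟨A, ⟨hA, (hsub A hA).2 (h ▸ hxP)⟩, by simp [h]⟩
    · rintro (⟨A, ⟨hA, hAP⟩, h⟩ | ⟨A, ⟨hA, hAP⟩, h⟩) <;> obtain ⟨rfl, rfl⟩ := Prod.mk.inj h
      · have := (hchar A hA _).2 (Or.inl rfl)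
        exact ⟨hA, this.1, this.2, (hmeet A hA).1 hAP⟩
      · have := (hchar A hA _).2 (Or.inr rfl)
        exact ⟨hA, this.1, this.2, (hsub A hA).1 hAP⟩
  have hPe : fNum P 1 = {A | A ∈ Ed ∧ A ⊆ P}.ncard := by
    rw [fNum]
    congr 1
    ext A
    simp only [Set.mem_ofPred_eq, hEd, hR.isFace_orbitHull_iff hPR hP hγ hconst]
    tauto
  have hEdge : ∀ g ∈ rootGroup R, ∀ A ∈ Ed, (g '' A) ∈ Ed := by
    intro g hg A hA
    refine ⟨isFace_apply_image hg hA.1, ?_⟩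
    rw [← hA.2]
    exact dimSet_image g.toLinearEquiv.toLinearMap.toAffineMap g.injective A
  have hinv : ∀ (g : F ≃ₗᵢ[ℝ] F) (A : Set F), g '' ((g⁻¹ : F ≃ₗᵢ[ℝ] F) '' A) = A := by
    intro g A
    rw [Set.image_image]
    have : (fun x => g (g⁻¹ x)) = id := funext fun x => g.apply_symm_apply x
    rw [this, Set.image_id]
  have hinj : Set.InjOn
      (fun p : rootGroup R × (Set F × F) => (p.1.1 '' p.2.1, p.1.1 p.2.2))
      (Set.univ ×ˢ {p : Set F × F | p.1 ∈ Ed ∧ p.2 ∈ p.1 ∧ IsFace Q {p.2} ∧ p.2 ∈ P}) := by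
    rintro ⟨⟨g, hg⟩, A, x⟩ ⟨-, hx⟩ ⟨⟨h, hh⟩, B, y⟩ ⟨-, hy⟩ hxy
    obtain ⟨h1, h2⟩ := Prod.mk.inj hxy
    obtain ⟨rfl, rfl⟩ := hR.eq_and_eq_of_apply_eq hPR hg hh hx.2.2.2 hy.2.2.2 h2
    have : A = B := g.injective.image_injective h1
    subst this
    rfl
  -- Moving the vertex of a flag back into `P` moves the whole flag; with `hinj`, the flags are
  -- `|𝔊|` disjoint copies of those with vertex in `P`.
  have himg : (fun p : rootGroup R × (Set F × F) => (p.1.1 '' p.2.1, p.1.1 p.2.2)) ''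
      (Set.univ ×ˢ {p : Set F × F | p.1 ∈ Ed ∧ p.2 ∈ p.1 ∧ IsFace Q {p.2} ∧ p.2 ∈ P}) =
      {p : Set F × F | p.1 ∈ Ed ∧ p.2 ∈ p.1 ∧ IsFace Q {p.2}} := by
    ext ⟨A, x⟩
    constructor
    · rintro ⟨⟨⟨g, hg⟩, B, y⟩, ⟨-, hB, hyB, hyf, hyP⟩, h⟩
      obtain ⟨rfl, rfl⟩ := Prod.mk.inj h
      have := isFace_apply_image hg hyf
      rw [Set.image_singleton] at this
      exact ⟨hEdge g hg B hB, Set.mem_image_of_mem _ hyB, this⟩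
    · rintro ⟨hA, hx, hxf⟩
      obtain ⟨g, hg, v, hv, hvf, h⟩ := exists_of_isFace_singleton hxf
      change x = g v at h
      subst h
      refine ⟨(⟨g, hg⟩, (g⁻¹ : F ≃ₗᵢ[ℝ] F) '' A, v), ⟨trivial, hEdge _ (inv_mem hg) A hA, ?_, hvf, hv⟩, ?_⟩
      · exact ⟨g v, hx, g.symm_apply_apply v⟩
      · simp only [hinv]
  have hT := hinj.ncard_image
  rw [himg, Set.ncard_prod, Set.ncard_univ, hflags, hflagsP, hcount _ _ subset_rfl subset_rfl,
    hcount _ _ (fun A h => h.1) (fun A h => h.1), ← hPe] at hT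
  change 2 * Ed.ncard = _
  rw [two_mul]
  exact hT

/-- The cones of codimension one in the fundamental fan correspond to the edges of the orbit
polytope that meet `P`. -/
theorem ncard_fundamentalFan [FiniteDimensional ℝ F] (hP : IsPolytope P) :
    {τ | (∃ A, IsFace P A ∧ IsFace (normalCone A P ∩ chamber R) τ) ∧
      dimSet τ + 1 = Module.finrank ℝ F}.ncard =
    {A | (IsFace (orbitHull R P) A ∧ dimSet A = 1) ∧ (A ∩ P).Nonempty}.ncard := by
  have hQ := isPolytope_orbitHull (R := R) hP
  have hinj : Set.InjOn (fun A => normalCone A (orbitHull R P))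
      {A | (IsFace (orbitHull R P) A ∧ dimSet A = 1) ∧ (A ∩ P).Nonempty} :=
    IsPolytope.normalCone_injOn.mono fun A h => h.1.1
  rw [← hinj.ncard_image]
  congr 1
  ext τ
  constructor
  · rintro ⟨⟨A, hA, hτ⟩, hd⟩
    rw [← hR.normalCone_orbitHull hPR hA.subset hA.2] at hτ
    obtain ⟨B, hB, hAB, rfl⟩ := hQ.exists_face_of_isFace_normalCone
      (hA.subset.trans (subset_orbitHull R P)) hA.2 hτ
    have := hQ.dimSet_normalCone hB
    refine ⟨B, ⟨⟨hB, by lia⟩, ?_⟩, rfl⟩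
    obtain ⟨x, hx⟩ := hA.2
    exact ⟨x, hAB hx, hA.subset hx⟩
  · rintro ⟨B, ⟨⟨hB, hd⟩, hn⟩, rfl⟩
    -- The normal cone at `B` is a face of the one at its subset `B ∩ P`, which is a cone of the
    -- normal fan of `P` cut by the chamber.
    refine ⟨⟨B ∩ P, isFace_inter_of_subset (subset_orbitHull R P) hB hn, ?_⟩, ?_⟩
    · rw [← hR.normalCone_orbitHull hPR Set.inter_subset_right hn]
      exact IsPolytope.isFace_normalCone hQ hn hB Set.inter_subset_left
    · rw [← hd]
      exact hQ.dimSet_normalCone hB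

end IsPositiveSystem

end Orbit

end Symmetrization

namespace Symmetrization

/-! ### Transfer between `V` and the dual pair `U`, `W`. -/

section Transfer

/-- The segment from `y` to `x` can be prolonged beyond `x`, since its line stays in the affine
span. This is the only property of relative interiors that is needed. -/
theorem exists_add_smul_mem_of_mem_intrinsicInterior {X : Type*} [AddCommGroup X] [Module ℝ X]
    [TopologicalSpace X] [IsTopologicalAddGroup X] [ContinuousSMul ℝ X] {s : Set X} {x y : X}
    (hx : x ∈ intrinsicInterior ℝ s) (hy : y ∈ s) : ∃ ε : ℝ, 0 < ε ∧ x + ε • (x - y) ∈ s := by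
  obtain ⟨z, hz, rfl⟩ := mem_intrinsicInterior.1 hx
  have hmem : ∀ ε : ℝ, (z : X) + ε • ((z : X) - y) ∈ affineSpan ℝ s := by
    intro ε
    have := AffineSubspace.vadd_mem_of_mem_direction (Submodule.smul_mem _ ε
      (AffineSubspace.vsub_mem_direction z.2 (subset_affineSpan ℝ s hy))) z.2
    rwa [vadd_eq_add, add_comm, vsub_eq_sub] at this
  let f : ℝ → affineSpan ℝ s := fun ε => ⟨(z : X) + ε • ((z : X) - y), hmem ε⟩
  have hf : Continuous f := by
    apply Continuous.subtype_mk
    fun_prop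
  have hf0 : f 0 = z := Subtype.ext (by simp [f])
  have h1 : ∀ᶠ ε in nhds (0 : ℝ), f ε ∈ interior ((↑) ⁻¹' s : Set (affineSpan ℝ s)) :=
    hf.continuousAt.eventually (by rw [hf0]; exact isOpen_interior.mem_nhds hz)
  have h2 : ∀ᶠ ε in nhdsWithin (0 : ℝ) (Set.Ioi 0),
      f ε ∈ interior ((↑) ⁻¹' s : Set (affineSpan ℝ s)) := h1.filter_mono nhdsWithin_le_nhds
  obtain ⟨ε, h, hε⟩ := (h2.and self_mem_nhdsWithin).exists
  have h3 : f ε ∈ ((↑) ⁻¹' s : Set (affineSpan ℝ s)) := interior_subset h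
  exact ⟨ε, hε, h3⟩

/-- Additive constants do not affect maximizers, so functionals need only correspond up to a
constant; this covers the translation by `x₀`. -/
theorem isFace_image_iff {X Y : Type*} [AddCommGroup X] [Module ℝ X] [TopologicalSpace X]
    [AddCommGroup Y] [Module ℝ Y] [TopologicalSpace Y] {f : X → Y}
    (hpull : ∀ l : Y →L[ℝ] ℝ, ∃ (m : X →L[ℝ] ℝ) (k : ℝ), ∀ x, l (f x) = m x + k)
    (hpush : ∀ m : X →L[ℝ] ℝ, ∃ (l : Y →L[ℝ] ℝ) (k : ℝ), ∀ x, l (f x) = m x + k)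
    {A : Set X} {B : Set Y} : IsFace (f '' A) B ↔ ∃ C, IsFace A C ∧ f '' C = B := by
  have key : ∀ (l : Y →L[ℝ] ℝ) (m : X →L[ℝ] ℝ) (k : ℝ), (∀ x, l (f x) = m x + k) →
      f '' {x ∈ A | ∀ y ∈ A, m y ≤ m x} = {x ∈ f '' A | ∀ y ∈ f '' A, l y ≤ l x} := by
    intro l m k h
    ext y
    constructor
    · rintro ⟨x, ⟨hxA, hx⟩, rfl⟩
      refine ⟨⟨x, hxA, rfl⟩, ?_⟩
      rintro _ ⟨z, hz, rfl⟩
      rw [h, h]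
      linarith [hx z hz]
    · rintro ⟨⟨x, hxA, rfl⟩, hx⟩
      refine ⟨x, ⟨hxA, fun z hz => ?_⟩, rfl⟩
      have := hx _ ⟨z, hz, rfl⟩
      rw [h, h] at this
      linarith
  constructor
  · rintro ⟨hB, hn⟩
    obtain ⟨l, rfl⟩ := hB hn
    obtain ⟨m, k, h⟩ := hpull l
    rw [← key l m k h] at hn ⊢
    exact ⟨_, ⟨fun _ => ⟨m, rfl⟩, hn.of_image⟩, rfl⟩
  · rintro ⟨C, ⟨hC, hn⟩, rfl⟩
    obtain ⟨m, rfl⟩ := hC hn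
    obtain ⟨l, k, h⟩ := hpush m
    refine ⟨fun _ => ⟨l, ?_⟩, hn.image f⟩
    rw [key l m k h]

variable {E : Type*} [NormedAddCommGroup E] [InnerProductSpace ℝ E] [FiniteDimensional ℝ E]

/-- The parametrization of `U = V + x₀` by `V`. -/
def shift (V : Submodule ℝ E) (x₀ : E) : V →ᵃ[ℝ] E where
  toFun v := v + x₀
  linear := V.subtype
  map_vadd' v w := by simp [add_assoc]

variable {V : Submodule ℝ E} {x₀ : E}

omit [FiniteDimensional ℝ E] in
theorem shift_apply (v : V) : shift V x₀ v = v + x₀ := rfl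

omit [FiniteDimensional ℝ E] in
theorem shift_injective : Function.Injective (shift V x₀) := fun _ _ h =>
  Subtype.ext (add_right_cancel h)

omit [FiniteDimensional ℝ E] in
theorem range_shift : Set.range (shift V x₀) = affU V x₀ := by
  ext u
  simp only [affU, SetLike.mem_coe, AffineSubspace.mem_mk', vsub_eq_sub]
  constructor
  · rintro ⟨v, rfl⟩
    rw [shift_apply, add_sub_cancel_right]
    exact v.2
  · exact fun h => ⟨⟨u - x₀, h⟩, by rw [shift_apply]; exact sub_add_cancel u x₀⟩

theorem isFace_shift_image_iff {A : Set V} {B : Set E} :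
    IsFace (shift V x₀ '' A) B ↔ ∃ C, IsFace A C ∧ shift V x₀ '' C = B := by
  refine isFace_image_iff (fun l => ⟨l.comp V.subtypeL, l x₀, fun v => ?_⟩)
    (fun m => ⟨m.comp V.orthogonalProjectionOnto, m (V.orthogonalProjectionOnto x₀), fun v => ?_⟩)
  · simp [shift_apply]
  · simp [shift_apply]

theorem fNum_shift_image (A : Set V) (i : ℕ) : fNum (shift V x₀ '' A) i = fNum A i := by
  rw [fNum, fNum, ← Set.ncard_image_of_injective _ (shift_injective (x₀ := x₀)).image_injective]
  congr 1
  ext B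
  constructor
  · rintro ⟨hB, hd⟩
    obtain ⟨C, hC, rfl⟩ := isFace_shift_image_iff.1 hB
    rw [dimSet_image _ shift_injective] at hd
    exact ⟨C, ⟨hC, hd⟩, rfl⟩
  · rintro ⟨C, ⟨hC, hd⟩, rfl⟩
    exact ⟨isFace_shift_image_iff.2 ⟨C, hC, rfl⟩, by rwa [dimSet_image _ shift_injective]⟩

omit [FiniteDimensional ℝ E] in
theorem exists_shift_image {P : Set E} (hP : IsPolytopeIn V x₀ P) :
    ∃ P' : Set V, IsPolytope P' ∧ P = shift V x₀ '' P' := by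
  obtain ⟨⟨s, rfl⟩, hU⟩ := hP
  have hs : (s : Set E) ⊆ Set.range (shift V x₀) := by
    rw [range_shift]
    exact (subset_convexHull ℝ _).trans hU
  refine ⟨convexHull ℝ (shift V x₀ ⁻¹' s),
    ⟨_, s.finite_toSet.preimage shift_injective.injOn, rfl⟩, ?_⟩
  rw [AffineMap.image_convexHull, Set.image_preimage_eq_of_subset hs]

theorem rep_symm_apply (v : V) : (rep V).symm v = Vᗮ.mkQ (v : E) := by
  rw [rep, Submodule.quotientEquivOfIsCompl_symm_apply]
  rfl

theorem mkQ_shift (hx₀ : x₀ ∈ Vᗮ) (v : V) : Vᗮ.mkQ (shift V x₀ v) = (rep V).symm v := by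
  rw [shift_apply, map_add, rep_symm_apply]
  simpa using hx₀

theorem pairing_shift (w : DualSp V) (v : V) :
    pairing V x₀ w (shift V x₀ v) = ⟪rep V w, v⟫_ℝ := by
  rw [pairing, shift_apply, add_sub_cancel_right, Submodule.coe_inner]

theorem isFace_rep_symm_image_iff {A : Set V} {B : Set (DualSp V)} :
    IsFace ((rep V).symm '' A) B ↔ ∃ C, IsFace A C ∧ (rep V).symm '' C = B := by
  have : IsClosed (Vᗮ : Set E) := Submodule.isClosed_orthogonal V
  have h1 : Continuous (rep V).toLinearMap := LinearMap.continuous_of_finiteDimensional _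
  have h2 : Continuous (rep V).symm.toLinearMap := LinearMap.continuous_of_finiteDimensional _
  refine isFace_image_iff
    (fun l => ⟨l.comp ⟨(rep V).symm.toLinearMap, h2⟩, 0, fun v => ?_⟩)
    (fun m => ⟨m.comp ⟨(rep V).toLinearMap, h1⟩, 0, fun v => ?_⟩)
  · simp
  · simp

/-- The action on `W` of an isometry of `V`. -/
noncomputable def isometryHom (V : Submodule ℝ E) :
    (V ≃ₗᵢ[ℝ] V) →* (DualSp V ≃ₗ[ℝ] DualSp V) where
  toFun g := (rep V).trans (g.toLinearEquiv.trans (rep V).symm)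
  map_one' := by
    ext w
    exact (rep V).symm_apply_apply w
  map_mul' g h := by
    refine LinearEquiv.ext fun w => ?_
    change (rep V).symm (g (h (rep V w))) =
      (rep V).symm (g (rep V ((rep V).symm (h (rep V w)))))
    rw [LinearEquiv.apply_symm_apply]

theorem isometryHom_apply (g : V ≃ₗᵢ[ℝ] V) (w : DualSp V) :
    isometryHom V g w = (rep V).symm (g (rep V w)) := rfl

theorem isometryHom_injective : Function.Injective (isometryHom V) := by
  intro g h hgh
  ext v
  have := LinearEquiv.congr_fun hgh ((rep V).symm v)
  rw [isometryHom_apply, isometryHom_apply, LinearEquiv.apply_symm_apply] at this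
  rw [(rep V).symm.injective this]

/-- The dual action is by the adjoint, and the adjoint of an isometry is its inverse. Orbits are
unaffected. -/
theorem act_shift (g : V ≃ₗᵢ[ℝ] V) (v : V) :
    act V x₀ (shift V x₀ v) (isometryHom V g) = shift V x₀ (g⁻¹ v) := by
  rw [act, shift_apply, add_sub_cancel_right, shift_apply,
    Submodule.orthogonalProjectionOnto_mem_subspace_eq_self]
  congr 2
  refine ext_inner_right ℝ fun y => ?_
  rw [LinearMap.adjoint_inner_left, inner_symm_apply]
  congr 1
  simp [LinearEquiv.conj_apply, isometryHom_apply]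

theorem symmetrization_shift_image (R P : Set V) :
    symmetrization V x₀ ((rootGroup R).map (isometryHom V)) (shift V x₀ '' P) =
      shift V x₀ '' orbitHull R P := by
  rw [symmetrization, orbitHull, AffineMap.image_convexHull]
  congr 1
  ext y
  constructor
  · rintro ⟨_, ⟨g, hg, rfl⟩, _, ⟨x, hx, rfl⟩, rfl⟩
    exact ⟨_, ⟨g⁻¹, inv_mem hg, x, hx, rfl⟩, (act_shift g x).symm⟩
  · rintro ⟨_, ⟨g, hg, x, hx, rfl⟩, rfl⟩
    exact ⟨_, ⟨g⁻¹, inv_mem hg, rfl⟩, _, ⟨x, hx, rfl⟩, by rw [act_shift, inv_inv]⟩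

theorem ncone_shift_image (A P : Set V) :
    ncone V x₀ (shift V x₀ '' A) (shift V x₀ '' P) = (rep V).symm '' normalCone A P := by
  ext w
  rw [LinearEquiv.image_symm_eq_preimage]
  simp only [ncone, normalCone, Set.forall_mem_image, pairing_shift, Set.mem_preimage,
    Set.mem_ofPred_eq]

theorem fCodim_FFan_shift_image {Φ : Set (DualSp V)} {R P : Set V}
    (hΦ : Φ = (rep V).symm '' chamber R) :
    fCodim (FFan V x₀ Φ (shift V x₀ '' P)) 1 =
      {τ | (∃ A, IsFace P A ∧ IsFace (normalCone A P ∩ chamber R) τ) ∧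
        dimSet τ + 1 = Module.finrank ℝ V}.ncard := by
  have hdim : ∀ τ : Set V, dimSet ((rep V).symm '' τ) = dimSet τ := fun τ =>
    dimSet_image (rep V).symm.toLinearMap.toAffineMap (rep V).symm.injective τ
  rw [fCodim, ← Set.ncard_image_of_injective _ (rep V).symm.injective.image_injective,
    (rep V).finrank_eq]
  congr 1
  ext τ
  constructor
  · rintro ⟨⟨_, ⟨B, hB, rfl⟩, hτ⟩, hd⟩
    obtain ⟨A, hA, rfl⟩ := isFace_shift_image_iff.1 hB
    rw [ncone_shift_image, hΦ, ← Set.image_inter (rep V).symm.injective,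
      isFace_rep_symm_image_iff] at hτ
    obtain ⟨C, hC, rfl⟩ := hτ
    rw [hdim] at hd
    exact ⟨C, ⟨⟨A, hA, hC⟩, hd⟩, rfl⟩
  · rintro ⟨C, ⟨⟨A, hA, hC⟩, hd⟩, rfl⟩
    refine ⟨⟨_, ⟨_, isFace_shift_image_iff.2 ⟨A, hA, rfl⟩, rfl⟩, ?_⟩, by rwa [hdim]⟩
    rw [ncone_shift_image, hΦ, ← Set.image_inter (rep V).symm.injective,
      isFace_rep_symm_image_iff]
    exact ⟨C, hC, rfl⟩

/-! ### The positive system of a reflection arrangement -/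

/-- The hyperplane of `W` orthogonal to `α`. -/
noncomputable def rootHyperplane (α : V) : Submodule ℝ (DualSp V) := (ℝ ∙ α)ᗮ.comap (rep V).toLinearMap

theorem mem_rootHyperplane {α : V} {w : DualSp V} :
    w ∈ rootHyperplane α ↔ ⟪α, rep V w⟫_ℝ = 0 := by
  rw [rootHyperplane, Submodule.mem_comap]
  exact Submodule.mem_orthogonal_singleton_iff_inner_right

theorem refl_rootHyperplane (α : V) :
    refl V (rootHyperplane α) = isometryHom V (rootRefl α) := by
  have h : (rootHyperplane α).map (rep V).toLinearMap = (ℝ ∙ α)ᗮ :=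
    Submodule.map_comap_eq_of_surjective (rep V).surjective _
  refine LinearEquiv.ext fun w => ?_
  change (rep V).symm (((rootHyperplane α).map (rep V).toLinearMap).reflection (rep V w)) =
    (rep V).symm ((ℝ ∙ α)ᗮ.reflection (rep V w))
  simp only [h]

theorem rootHyperplane_neg (α : V) : rootHyperplane (-α) = rootHyperplane α := by
  ext w
  rw [mem_rootHyperplane, mem_rootHyperplane, inner_neg_left, neg_eq_zero]

theorem isHyperplane_rootHyperplane {α : V} (hα : ‖α‖ = 1) :
    IsHyperplane (rootHyperplane α) := by
  have hα0 : α ≠ 0 := fun h => by simp [h] at hα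
  have h1 : Module.finrank ℝ (rootHyperplane α) = Module.finrank ℝ ((ℝ ∙ α)ᗮ : Submodule ℝ V) := by
    have h : (rootHyperplane α).map (rep V).toLinearMap = (ℝ ∙ α)ᗮ :=
      Submodule.map_comap_eq_of_surjective (rep V).surjective _
    rw [← h]
    exact (LinearEquiv.finrank_map_eq (rep V) (rootHyperplane α)).symm
  have h2 := Submodule.finrank_add_finrank_orthogonal (ℝ ∙ α)
  have h3 := Submodule.finrank_quotient_add_finrank (rootHyperplane α)
  have h4 := (rep V).finrank_eq
  rw [finrank_span_singleton hα0] at h2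
  rw [IsHyperplane]
  lia

theorem exists_eq_rootHyperplane {H : Submodule ℝ (DualSp V)} (hH : IsHyperplane H) :
    ∃ α : V, ‖α‖ = 1 ∧ H = rootHyperplane α := by
  set K := H.map (rep V).toLinearMap with hK
  have h1 : Module.finrank ℝ K = Module.finrank ℝ H := LinearEquiv.finrank_map_eq (rep V) H
  have h2 := Submodule.finrank_add_finrank_orthogonal K
  have h3 := Submodule.finrank_quotient_add_finrank H
  have h4 := (rep V).finrank_eq
  rw [IsHyperplane] at hH
  have h5 : Module.finrank ℝ Kᗮ = 1 := by lia
  obtain ⟨⟨v, hv⟩, hv0, hspan⟩ := finrank_eq_one_iff'.1 h5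
  have hv0' : v ≠ 0 := fun h => hv0 (Subtype.ext h)
  refine ⟨‖v‖⁻¹ • v, norm_smul_inv_norm hv0', ?_⟩
  have hKv : Kᗮ = ℝ ∙ v := by
    apply le_antisymm
    · intro u hu
      obtain ⟨c, hc⟩ := hspan ⟨u, hu⟩
      exact Submodule.mem_span_singleton.2 ⟨c, congrArg Subtype.val hc⟩
    · rwa [Submodule.span_singleton_le_iff_mem]
  have hKv' : K = (ℝ ∙ v)ᗮ := by rw [← hKv, Submodule.orthogonal_orthogonal]
  ext w
  rw [mem_rootHyperplane, real_inner_smul_left, mul_eq_zero,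
    or_iff_right (inv_ne_zero (norm_ne_zero_iff.2 hv0')),
    ← Submodule.mem_orthogonal_singleton_iff_inner_right, ← hKv', hK]
  refine ⟨fun h => ⟨w, h, rfl⟩, ?_⟩
  rintro ⟨u, hu, h⟩
  rwa [← (rep V).injective h]

/-- The unit normals of the hyperplanes of an arrangement, on the side of `w₀`. -/
def positiveRoots (𝓗 : Set (Submodule ℝ (DualSp V))) (w₀ : DualSp V) : Set V :=
  {α | ‖α‖ = 1 ∧ 0 < ⟪α, rep V w₀⟫_ℝ ∧ rootHyperplane α ∈ 𝓗}

variable {𝓗 : Set (Submodule ℝ (DualSp V))} {w₀ : DualSp V}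

theorem mem_positiveRoots_or_neg_mem (hw₀ : ∀ H ∈ 𝓗, w₀ ∉ H) {α : V} (hα : ‖α‖ = 1)
    (h : rootHyperplane α ∈ 𝓗) : α ∈ positiveRoots 𝓗 w₀ ∨ -α ∈ positiveRoots 𝓗 w₀ := by
  have h0 := mt mem_rootHyperplane.2 (hw₀ _ h)
  rcases lt_or_gt_of_ne h0 with h1 | h1
  · refine Or.inr ⟨by rwa [norm_neg], ?_, by rwa [rootHyperplane_neg]⟩
    rw [inner_neg_left]
    linarith
  · exact Or.inl ⟨hα, h1, h⟩

theorem exists_mem_positiveRoots (h𝓗 : IsReflectionArrangement 𝓗) (hw₀ : ∀ H ∈ 𝓗, w₀ ∉ H)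
    {H : Submodule ℝ (DualSp V)} (hH : H ∈ 𝓗) :
    ∃ α ∈ positiveRoots 𝓗 w₀, H = rootHyperplane α := by
  obtain ⟨α, hα, rfl⟩ := exists_eq_rootHyperplane (h𝓗.hyperplane H hH)
  rcases mem_positiveRoots_or_neg_mem hw₀ hα hH with h | h
  · exact ⟨α, h, rfl⟩
  · exact ⟨-α, h, (rootHyperplane_neg α).symm⟩

theorem map_rootGroup (h𝓗 : IsReflectionArrangement 𝓗) (hw₀ : ∀ H ∈ 𝓗, w₀ ∉ H) :
    (rootGroup (positiveRoots 𝓗 w₀)).map (isometryHom V) = reflGroup 𝓗 := by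
  rw [rootGroup, reflGroup, MonoidHom.map_closure]
  congr 1
  ext g
  constructor
  · rintro ⟨_, ⟨α, hα, rfl⟩, rfl⟩
    exact ⟨_, hα.2.2, refl_rootHyperplane α⟩
  · rintro ⟨H, hH, rfl⟩
    obtain ⟨α, hα, rfl⟩ := exists_mem_positiveRoots h𝓗 hw₀ hH
    exact ⟨_, ⟨α, hα, rfl⟩, (refl_rootHyperplane α).symm⟩

theorem isPositiveSystem_positiveRoots (h𝓗 : IsReflectionArrangement 𝓗)
    (hw₀ : ∀ H ∈ 𝓗, w₀ ∉ H) : IsPositiveSystem (positiveRoots 𝓗 w₀) (rep V w₀) where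
  finite := by
    refine Set.Finite.of_finite_image (f := rootHyperplane)
      (h𝓗.finite.subset (by rintro _ ⟨α, hα, rfl⟩; exact hα.2.2)) ?_
    intro α hα β hβ hαβ
    have hspan : (ℝ ∙ α)ᗮ = (ℝ ∙ β)ᗮ :=
      Submodule.comap_injective_of_surjective (rep V).surjective hαβ
    have hspan' : (ℝ ∙ α) = ℝ ∙ β := by
      rw [← Submodule.orthogonal_orthogonal (ℝ ∙ α), hspan, Submodule.orthogonal_orthogonal]
    obtain ⟨c, hc⟩ := Submodule.mem_span_singleton.1
      (hspan' ▸ Submodule.mem_span_singleton_self α)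
    have hn := hα.1
    rw [← hc, norm_smul, hβ.1, mul_one, Real.norm_eq_abs] at hn
    have hpos := hα.2.1
    rw [← hc, real_inner_smul_left] at hpos
    have hc0 : 0 < c := pos_of_mul_pos_left hpos hβ.2.1.le
    rw [abs_of_pos hc0] at hn
    rw [← hc, hn, one_smul]
  norm_eq_one α hα := hα.1
  pos α hα := hα.2.1
  refl_mem α hα β hβ := by
    have hnorm : ‖rootRefl α β‖ = 1 := by rw [LinearIsometryEquiv.norm_map, hβ.1]
    refine mem_positiveRoots_or_neg_mem hw₀ hnorm
      (h𝓗.all_reflections _ (isHyperplane_rootHyperplane hnorm) ?_)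
    -- The reflection in `rootRefl α β` is a conjugate of that in `β`, hence in the group, and `𝓗`
    -- contains all reflecting hyperplanes.
    rw [refl_rootHyperplane, rootRefl_map hβ.1, ← map_rootGroup h𝓗 hw₀]
    have h1 : rootRefl α ∈ rootGroup (positiveRoots 𝓗 w₀) :=
      Subgroup.subset_closure ⟨α, hα, rfl⟩
    have h2 : rootRefl β ∈ rootGroup (positiveRoots 𝓗 w₀) :=
      Subgroup.subset_closure ⟨β, hβ, rfl⟩
    exact Subgroup.mem_map_of_mem _ (mul_mem (mul_mem h1 h2) (inv_mem h1))

theorem chamber_positiveRoots (h𝓗 : IsReflectionArrangement 𝓗) (hw₀ : ∀ H ∈ 𝓗, w₀ ∉ H) :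
    {w | ∀ H ∈ 𝓗, ∀ f : DualSp V →ₗ[ℝ] ℝ, LinearMap.ker f = H → 0 ≤ f w₀ * f w} =
      (rep V).symm '' chamber (positiveRoots 𝓗 w₀) := by
  rw [LinearEquiv.image_symm_eq_preimage]
  ext w
  constructor
  · intro h α hα
    have h1 := h _ hα.2.2 ((innerₗ V α) ∘ₗ (rep V).toLinearMap) (by
      ext u
      rw [mem_rootHyperplane]
      rfl)
    exact nonneg_of_mul_nonneg_right h1 hα.2.1
  · intro h H hH f hf
    obtain ⟨α, hα, rfl⟩ := exists_mem_positiveRoots h𝓗 hw₀ hH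
    have hpos := hα.2.1
    have hw := h α hα
    -- This combination is orthogonal to `α`, so it is killed by any `f` with the same kernel; thus
    -- `f` is compared with `⟪α, ·⟫` without computing the proportionality factor.
    have h1 : ⟪α, rep V w₀⟫_ℝ • w - ⟪α, rep V w⟫_ℝ • w₀ ∈ LinearMap.ker f := by
      rw [hf, mem_rootHyperplane, map_sub, map_smul, map_smul, inner_sub_right,
        real_inner_smul_right, real_inner_smul_right]
      ring
    rw [LinearMap.mem_ker, map_sub, map_smul, map_smul, smul_eq_mul, smul_eq_mul] at h1
    have h2 : ⟪α, rep V w₀⟫_ℝ * (f w₀ * f w) = ⟪α, rep V w⟫_ℝ * (f w₀ * f w₀) := by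
      linear_combination f w₀ * h1
    have h3 : 0 ≤ ⟪α, rep V w₀⟫_ℝ * (f w₀ * f w) := by
      rw [h2]
      exact mul_nonneg hw (mul_self_nonneg _)
    exact nonneg_of_mul_nonneg_right h3 hpos

-- Were `⟪α, v⟫ ≤ 0` for some root, moving away from `v₀` would make it negative.
omit [FiniteDimensional ℝ E] in
theorem mem_openChamber_of_add_smul_mem {R : Set V} {v v₀ : V} (hv₀ : v₀ ∈ openChamber R) {ε : ℝ}
    (hε : 0 < ε) (h : v + ε • (v - v₀) ∈ chamber R) : v ∈ openChamber R := by
  intro α hα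
  have h1 := h α hα
  rw [inner_add_right, real_inner_smul_right, inner_sub_right] at h1
  have h2 := mul_pos hε (hv₀ α hα)
  by_contra hneg
  push Not at hneg
  nlinarith

theorem fNum_symmetrization (hx₀ : x₀ ∈ Vᗮ) (h𝓗 : IsReflectionArrangement 𝓗)
    {Φ : Set (DualSp V)} (hΦ : IsChamber 𝓗 Φ) {P : Set E} (hP : IsPolytopeIn V x₀ P)
    (hplaced : IsPlaced V x₀ Φ P) (happ : IsAppropriate (dualChamber V x₀ Φ) P) :
    fNum (symmetrization V x₀ (reflGroup 𝓗) P) 0 = Nat.card (reflGroup 𝓗) * fNum P 0 ∧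
      2 * fNum (symmetrization V x₀ (reflGroup 𝓗) P) 1 =
        Nat.card (reflGroup 𝓗) * (fCodim (FFan V x₀ Φ P) 1 + fNum P 1) := by
  obtain ⟨w₀, hw₀, hΦeq⟩ := hΦ
  obtain ⟨P, hPpoly, rfl⟩ := exists_shift_image hP
  obtain ⟨γ, hγ, hconst⟩ := hplaced
  rw [chamber_positiveRoots h𝓗 hw₀] at hΦeq
  have hR := isPositiveSystem_positiveRoots h𝓗 hw₀
  have hG := map_rootGroup h𝓗 hw₀
  set R := positiveRoots 𝓗 w₀
  have e : rootGroup R ≃* reflGroup 𝓗 :=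
    ((rootGroup R).equivMapOfInjective (isometryHom V) isometryHom_injective).trans
      (MulEquiv.subgroupCongr hG)
  have := h𝓗.finite_group
  have : Finite (rootGroup R) := Finite.of_equiv _ e.symm.toEquiv
  have hmemΦ : ∀ w, w ∈ Φ ↔ rep V w ∈ chamber R := by
    intro w
    rw [hΦeq, LinearEquiv.image_symm_eq_preimage]
    rfl
  have hw₀R : rep V w₀ ∈ openChamber R := fun α hα => hα.2.1
  have hw₀Φ : w₀ ∈ Φ := (hmemΦ _).2 (openChamber_subset R hw₀R)
  have hγR : rep V γ ∈ openChamber R := by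
    obtain ⟨ε, hε, h⟩ := exists_add_smul_mem_of_mem_intrinsicInterior hγ hw₀Φ
    rw [hmemΦ, map_add, map_smul, map_sub] at h
    exact mem_openChamber_of_add_smul_mem hw₀R hε h
  have hPR : P ⊆ openChamber R := by
    intro v hv
    have hmemΨ : ∀ u : V, shift V x₀ u ∈ dualChamber V x₀ Φ ↔ u ∈ chamber R := by
      intro u
      have hu : shift V x₀ u ∈ affU V x₀ := by
        rw [← SetLike.mem_coe, ← range_shift]
        exact ⟨u, rfl⟩
      rw [dualChamber, Set.mem_ofPred_eq, mkQ_shift hx₀, hmemΦ, LinearEquiv.apply_symm_apply]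
      exact and_iff_right hu
    obtain ⟨ε, hε, h⟩ := exists_add_smul_mem_of_mem_intrinsicInterior (happ ⟨v, hv, rfl⟩)
      ((hmemΨ (rep V w₀)).2 (openChamber_subset R hw₀R))
    have heq : shift V x₀ v + ε • (shift V x₀ v - shift V x₀ (rep V w₀)) =
        shift V x₀ (v + ε • (v - rep V w₀)) := by
      simp only [shift_apply, add_sub_add_right_eq_sub, Submodule.coe_add, Submodule.coe_smul,
        Submodule.coe_sub]
      abel
    rw [heq, hmemΨ] at h
    exact mem_openChamber_of_add_smul_mem hw₀R hε h
  have hconst' : ∀ x ∈ P, ∀ y ∈ P, ⟪rep V γ, x⟫_ℝ = ⟪rep V γ, y⟫_ℝ := by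
    intro x hx y hy
    have := hconst _ ⟨x, hx, rfl⟩ _ ⟨y, hy, rfl⟩
    rwa [pairing_shift, pairing_shift] at this
  rw [← Nat.card_congr e.toEquiv, ← hG, symmetrization_shift_image, fNum_shift_image,
    fNum_shift_image, fNum_shift_image, fNum_shift_image, fCodim_FFan_shift_image hΦeq,
    hR.ncard_fundamentalFan hPR hPpoly]
  exact ⟨hR.fNum_orbitHull_zero hPR hPpoly hγR hconst',
    hR.two_mul_fNum_orbitHull_one hPR hPpoly hγR hconst'⟩

end Transfer

end Symmetrization

theorem mainTheorem9 {E : Type*} [NormedAddCommGroup E] [InnerProductSpace ℝ E]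
    [FiniteDimensional ℝ E] (V : Submodule ℝ E) (x₀ : E) (hx₀ : x₀ ∈ Vᗮ)
    (𝓗 : Set (Submodule ℝ (DualSp V))) (h𝓗 : IsReflectionArrangement 𝓗)
    (Φ : Set (DualSp V)) (hΦ : IsChamber 𝓗 Φ) :
    (∀ P : Set E, IsPolytopeIn V x₀ P → IsPlaced V x₀ Φ P →
      IsAppropriate (dualChamber V x₀ Φ) P →
        fNum (symmetrization V x₀ (reflGroup 𝓗) P) 0 = Nat.card (reflGroup 𝓗) * fNum P 0 ∧
        (fNum (symmetrization V x₀ (reflGroup 𝓗) P) 1 : ℚ) =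
          (Nat.card (reflGroup 𝓗) : ℚ) / 2 *
            ((fCodim (FFan V x₀ Φ P) 1 : ℚ) + (fNum P 1 : ℚ))) ∧
    (∀ P Q : Set E, IsPolytopeIn V x₀ P → IsPlaced V x₀ Φ P →
      IsAppropriate (dualChamber V x₀ Φ) P →
      IsPolytopeIn V x₀ Q → IsPlaced V x₀ Φ Q →
      IsAppropriate (dualChamber V x₀ Φ) Q →
      fNum P 0 = fNum Q 0 → fNum P 1 = fNum Q 1 →
      fCodim (FFan V x₀ Φ P) 1 = fCodim (FFan V x₀ Φ Q) 1 →
        fNum (symmetrization V x₀ (reflGroup 𝓗) P) 0 =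
          fNum (symmetrization V x₀ (reflGroup 𝓗) Q) 0 ∧
        fNum (symmetrization V x₀ (reflGroup 𝓗) P) 1 =
          fNum (symmetrization V x₀ (reflGroup 𝓗) Q) 1) := by
  refine ⟨fun P hP hPp hPa => ?_, fun P Q hP hPp hPa hQ hQp hQa h0 h1 hF => ?_⟩
  · obtain ⟨h0, h1⟩ := fNum_symmetrization hx₀ h𝓗 hΦ hP hPp hPa
    refine ⟨h0, ?_⟩
    have h2 : (2 : ℚ) * (fNum (symmetrization V x₀ (reflGroup 𝓗) P) 1 : ℚ) =
        (Nat.card (reflGroup 𝓗) : ℚ) * ((fCodim (FFan V x₀ Φ P) 1 : ℚ) + (fNum P 1 : ℚ)) :=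
      mod_cast h1
    linarith
  · obtain ⟨hP0, hP1⟩ := fNum_symmetrization hx₀ h𝓗 hΦ hP hPp hPa
    obtain ⟨hQ0, hQ1⟩ := fNum_symmetrization hx₀ h𝓗 hΦ hQ hQp hQa
    refine ⟨by rw [hP0, hQ0, h0], ?_⟩
    rw [hF, h1, ← hQ1] at hP1
    lia
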